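/- Let $p\ge 2$ be an integer and let $G$ be the Vilenkin group: the sequences $x=(x_j)_{j\in\mathbb Z}$ with $x_j\in\{0,\dots,p-1\}$ and $x_j=0$ for all $j<k(x)$, under coordinatewise addition $\oplus$ modulo $p$, with the subgroups $U_l=\{x: x_j=0 \text{ for } j\le l\}$ as a basis of neighbourhoods of $0$ and Haar measure $\mu$ normalized by $\mu(U_0)=1$. The dual group $G^*$ consists of the same sequences with the same structure, through $\chi(x,\omega)=\exp\big(\tfrac{2\pi i}{p}\sum_{j}x_j\omega_{1-j}\big)$, and $\hat f$ is the Fourier transform on $L^2(G)$, that is, the $L^2(G^*)$-limit of $\int_{U_{-n}}f(x)\overline{\chi(x,\omega)}\,d\mu(x)$ as $n\to\infty$. Put $H=\{x\in G:x_j=0\text{ for }j>0\}$; its annihilator is $H^\perp=\{\omega\in G^*:\omega_j=0\text{ for }j>0\}$. Let $(Ax)_j=x_{j+1}$ on $G$ and $(B\omega)_j=\omega_{j+1}$ on $G^*$, let $T_hf(x)=f(x\ominus h)$, and for $0\le\zeta\le p-1$ let $0.\zeta\in G^*$ have coordinate $\zeta$ at $j=1$ and all other coordinates $0$. A Parseval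 FMRA with scaling function $\varphi$ is a sequence $(V_j)_{j\in\mathbb Z}$ of closed subspaces of $L^2(G)$ such that $V_j\subseteq V_{j+1}$ for all $j$; $f\in V_j$ if and only if $f(A\,\cdot)\in V_{j+1}$, for all $j$; $\overline{\bigcup_jV_j}=L^2(G)$; $\bigcap_jV_j=\{0\}$; and $\varphi\in V_0$ is such that $\{T_h\varphi:h\in H\}$ is a Parseval frame for $V_0$ (that is, it lies in $V_0$ and $\sum_{h\in H}|\langle f,T_h\varphi\rangle|^2=\|f\|^2$ for every $f\in V_0$). Its minimal low-pass filter is the $H^\perp$-periodic function $$m_\varphi(\omega)=\sum_{h\in H^\perp}\hat\varphi(B(\omega\oplus h))\,\overline{\hat\varphi(\omega\oplus h)} ,$$ and $E_\varphi=\{\omega\in G^*:\sum_{h\in H^\perp}|\hat\varphi(\omega\oplus h)|^2\ne0\}$. Let $(V_j)$ be a Parseval FMRA with scaling function $\varphi$ and minimal low-pass filter $m_\varphi$. Then $$\sum_{\zeta=0}^{p-1}|m_\varphi(\omega\oplus 0.\zeta)|^2=\mathbf 1_{E_\varphi}(B\omega)\qquad\text{for a.e. }\omega\in G^*.$$ 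-/

import Mathlib

open MeasureTheory Filter Topology
open scoped ComplexConjugate Pointwise ENNReal

/-- The additive subgroup of the sequences `x : ℤ → ℤ/p` with `x j = 0` for all `j < k`,
for some integer `k` depending on `x`. -/
def vilenkinSubgroup (p : ℕ) : AddSubgroup (ℤ → ZMod p) where
  carrier := {x | ∃ k : ℤ, ∀ j < k, x j = 0}
  zero_mem' := ⟨0, fun _ _ => rfl⟩
  add_mem' := by
    rintro x y ⟨k, hk⟩ ⟨l, hl⟩
    refine ⟨min k l, fun j hj => ?_⟩
    have h1 := hk j (lt_of_lt_of_le hj (min_le_left _ _))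
    have h2 := hl j (lt_of_lt_of_le hj (min_le_right _ _))
    simp [h1, h2]
  neg_mem' := by
    rintro x ⟨k, hk⟩
    exact ⟨k, fun j hj => by simp [hk j hj]⟩

/-- The Vilenkin group (its topology is not the one induced from the product). The dual group
consists of the same sequences, with the same operation, neighbourhoods of zero and Haar measure,
so the same type serves for both; the duality between the two copies is `Vilenkin.char`. -/
def Vilenkin (p : ℕ) : Type := vilenkinSubgroup p

namespace Vilenkin

variable {p : ℕ}

instance : AddCommGroup (Vilenkin p) := inferInstanceAs (AddCommGroup (vilenkinSubgroup p))

/-- The sequence of coordinates. -/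
def coord (x : Vilenkin p) : ℤ → ZMod p := (show vilenkinSubgroup p from x).1

instance : CoeFun (Vilenkin p) (fun _ => ℤ → ZMod p) := ⟨coord⟩

/-- The element with given coordinates. -/
def mk (x : ℤ → ZMod p) (hx : ∃ k : ℤ, ∀ j < k, x j = 0) : Vilenkin p :=
  show vilenkinSubgroup p from ⟨x, hx⟩

@[simp] theorem mk_apply (x : ℤ → ZMod p) (hx : ∃ k : ℤ, ∀ j < k, x j = 0) (j : ℤ) :
    mk x hx j = x j := rfl

theorem exists_bound (x : Vilenkin p) : ∃ k : ℤ, ∀ j < k, x j = 0 :=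
  (show vilenkinSubgroup p from x).2

theorem ext {x y : Vilenkin p} (h : ∀ j, x j = y j) : x = y := Subtype.ext (funext h)

@[simp] theorem zero_apply (j : ℤ) : (0 : Vilenkin p) j = 0 := rfl
@[simp] theorem add_apply (x y : Vilenkin p) (j : ℤ) : (x + y) j = x j + y j := rfl
@[simp] theorem neg_apply (x : Vilenkin p) (j : ℤ) : (-x) j = -x j := rfl
@[simp] theorem sub_apply (x y : Vilenkin p) (j : ℤ) : (x - y) j = x j - y j := rfl

/-- `U_l`, the sequences with `x j = 0` for all `j ≤ l`. -/
def U (p : ℕ) (l : ℤ) : AddSubgroup (Vilenkin p) where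
  carrier := {x | ∀ j ≤ l, x j = 0}
  zero_mem' := fun _ _ => rfl
  add_mem' := fun {x y} hx hy j hj => by simp [hx j hj, hy j hj]
  neg_mem' := fun {x} hx j hj => by simp [hx j hj]

theorem mem_U {l : ℤ} {x : Vilenkin p} : x ∈ U p l ↔ ∀ j ≤ l, x j = 0 := Iff.rfl

/-- The subgroups `U_l` as a basis of neighbourhoods of zero. -/
@[reducible] def basis (p : ℕ) : AddGroupFilterBasis (Vilenkin p) :=
  addGroupFilterBasisOfComm (Set.range fun l : ℤ => (U p l : Set (Vilenkin p)))
    ⟨_, 0, rfl⟩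
    (by
      rintro _ _ ⟨k, rfl⟩ ⟨l, rfl⟩
      refine ⟨_, ⟨max k l, rfl⟩, fun x hx => ⟨fun j hj => hx j ?_, fun j hj => hx j ?_⟩⟩
      · exact hj.trans (le_max_left _ _)
      · exact hj.trans (le_max_right _ _))
    (by rintro _ ⟨l, rfl⟩; exact (U p l).zero_mem)
    (by
      rintro _ ⟨l, rfl⟩
      refine ⟨_, ⟨l, rfl⟩, ?_⟩
      rintro _ ⟨x, hx, y, hy, rfl⟩
      exact (U p l).add_mem hx hy)
    (by
      rintro _ ⟨l, rfl⟩
      exact ⟨_, ⟨l, rfl⟩, fun x hx => (U p l).neg_mem hx⟩)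

instance : TopologicalSpace (Vilenkin p) := (basis p).topology

instance : IsTopologicalAddGroup (Vilenkin p) := (basis p).isTopologicalAddGroup

instance : MeasurableSpace (Vilenkin p) := borel _

instance : BorelSpace (Vilenkin p) := ⟨rfl⟩

theorem U_mem_nhds (l : ℤ) : (U p l : Set (Vilenkin p)) ∈ 𝓝 (0 : Vilenkin p) :=
  (basis p).mem_nhds_zero ⟨l, rfl⟩

theorem mem_nhds_iff {x : Vilenkin p} {s : Set (Vilenkin p)} :
    s ∈ 𝓝 x ↔ ∃ l : ℤ, ∀ y, y - x ∈ U p l → y ∈ s := by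
  rw [((basis p).nhds_hasBasis x).mem_iff]
  constructor
  · rintro ⟨_, ⟨l, rfl⟩, h⟩
    exact ⟨l, fun y hy => h ⟨y - x, hy, by simp⟩⟩
  · rintro ⟨l, h⟩
    refine ⟨_, ⟨l, rfl⟩, ?_⟩
    rintro _ ⟨u, hu, rfl⟩
    exact h _ (by simpa using hu)

theorem isCompact_U [NeZero p] (l : ℤ) : IsCompact (U p l : Set (Vilenkin p)) := by
  let tr : (ℤ → ZMod p) → Vilenkin p := fun x =>
    mk (fun j => if j ≤ l then 0 else x j) ⟨l, fun j hj => if_pos hj.le⟩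
  have hc : Continuous tr := by
    rw [continuous_iff_continuousAt]
    intro x s hs
    obtain ⟨m, hm⟩ := mem_nhds_iff.1 hs
    have ho : ∀ j : ℤ, ∀ᶠ y in 𝓝 x, y j = x j := fun j =>
      ((continuous_apply j).continuousAt.eventually
        (isOpen_discrete ({x j} : Set (ZMod p)) |>.mem_nhds rfl))
    have hf : ∀ᶠ y in 𝓝 x, ∀ j ∈ Set.Ioc l m, y j = x j :=
      ((Set.finite_Ioc l m).eventually_all).2 fun j _ => ho j
    refine mem_map.2 (mem_of_superset hf fun y hy => ?_)
    refine hm _ fun j hj => ?_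
    change (if j ≤ l then 0 else y j) - (if j ≤ l then 0 else x j) = 0
    split_ifs with h
    · simp
    · rw [hy j ⟨not_le.1 h, hj⟩, sub_self]
  have hr : (U p l : Set (Vilenkin p)) = Set.range tr := by
    ext x
    constructor
    · intro hx
      refine ⟨x, ext fun j => ?_⟩
      change (if j ≤ l then 0 else x j) = x j
      split_ifs with h
      · exact (hx j h).symm
      · rfl
    · rintro ⟨y, rfl⟩ j hj
      exact if_pos hj
  rw [hr]
  exact isCompact_range hc

instance [NeZero p] : LocallyCompactSpace (Vilenkin p) :=
  (isCompact_U (p := p) 0).locallyCompactSpace_of_mem_nhds_of_addGroup (U_mem_nhds 0)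

/-- `U = U_0` as a compact set with nonempty interior. -/
def compactU (p : ℕ) [NeZero p] : TopologicalSpace.PositiveCompacts (Vilenkin p) where
  carrier := U p 0
  isCompact' := isCompact_U 0
  interior_nonempty' := ⟨0, mem_interior_iff_mem_nhds.2 (U_mem_nhds 0)⟩

/-- The Haar measure, normalized so that `U_0` has measure one. -/
noncomputable def haar (p : ℕ) [NeZero p] : Measure (Vilenkin p) :=
  Measure.addHaarMeasure (compactU p)

instance [NeZero p] : (haar p).IsAddHaarMeasure :=
  inferInstanceAs (Measure.addHaarMeasure (compactU p)).IsAddHaarMeasure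

instance [NeZero p] : (haar p).Regular :=
  inferInstanceAs (Measure.addHaarMeasure (compactU p)).Regular

theorem haar_U [NeZero p] : haar p (U p 0) = 1 := Measure.addHaarMeasure_self

/-- The space `L²` of the Vilenkin group. -/
noncomputable abbrev L2 (p : ℕ) [NeZero p] := Lp ℂ 2 (haar p)

/-- The discrete subgroup `H` of the sequences with `x j = 0` for all `j > 0`. In the dual copy of
the group the same sequences form the annihilator of `H`. -/
def H (p : ℕ) : AddSubgroup (Vilenkin p) where
  carrier := {x | ∀ j > 0, x j = 0}
  zero_mem' := fun _ _ => rfl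
  add_mem' := fun {x y} hx hy j hj => by simp [hx j hj, hy j hj]
  neg_mem' := fun {x} hx j hj => by simp [hx j hj]

/-- The automorphism `(A x) j = x (j + 1)`; the automorphism `B` of the dual copy is given by the
same formula. -/
def A (p : ℕ) : Vilenkin p ≃ₜ+ Vilenkin p where
  toFun x := mk (fun j => x (j + 1)) (x.exists_bound.elim fun k hk => ⟨k - 1, fun j hj => hk _ (by lia)⟩)
  invFun x := mk (fun j => x (j - 1)) (x.exists_bound.elim fun k hk => ⟨k + 1, fun j hj => hk _ (by lia)⟩)
  left_inv x := ext fun j => congrArg x.coord (by lia)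
  right_inv x := ext fun j => congrArg x.coord (by lia)
  map_add' _ _ := rfl
  continuous_toFun := by
    refine continuous_iff_continuousAt.2 fun x s hs => ?_
    obtain ⟨l, hl⟩ := mem_nhds_iff.1 hs
    exact mem_nhds_iff.2 ⟨l + 1, fun y hy => hl _ fun j hj => hy (j + 1) (by lia)⟩
  continuous_invFun := by
    refine continuous_iff_continuousAt.2 fun x s hs => ?_
    obtain ⟨l, hl⟩ := mem_nhds_iff.1 hs
    exact mem_nhds_iff.2 ⟨l - 1, fun y hy => hl _ fun j hj => hy (j - 1) (by lia)⟩

@[simp] theorem A_apply (x : Vilenkin p) (j : ℤ) : A p x j = x (j + 1) := rfl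

/-- The element `0.ζ`, whose coordinate at `1` is `ζ` and whose other coordinates are zero. -/
def frac (p : ℕ) (ζ : ZMod p) : Vilenkin p :=
  mk (Pi.single 1 ζ) ⟨1, fun _ hj => Pi.single_eq_of_ne hj.ne _⟩

/-- The character `χ(x, ω) = exp ((2 π i / p) ∑ j, x j * ω (1 - j))`; the sum has only finitely
many nonzero terms, and `ZMod.stdAddChar` sends the class of `n` to `exp (2 π i n / p)`. -/
noncomputable def char [NeZero p] (x ω : Vilenkin p) : ℂ :=
  ZMod.stdAddChar (∑ᶠ j : ℤ, x j * ω (1 - j))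

/-- The Fourier integral of `f` over the compact set `U_{-n}`, at `ω`. -/
noncomputable def truncFourier [NeZero p] (f : Vilenkin p → ℂ) (n : ℕ) (ω : Vilenkin p) : ℂ :=
  ∫ x in (U p (-(n : ℤ)) : Set (Vilenkin p)), f x * conj (char x ω) ∂(haar p)

/-- `F` is the Fourier transform of `f` in `L²`: the limit in `L²` of the Fourier integrals of `f`
over the increasing compact sets `U_{-n}`, which exhaust the group. -/
def IsFourierTransform [NeZero p] (f F : L2 p) : Prop :=
  Tendsto (fun n : ℕ => eLpNorm (fun ω => F ω - truncFourier f n ω) 2 (haar p)) atTop (𝓝 0)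

open Classical in
/-- The Fourier transform on `L²`, defined on all of `L²` by Plancherel's theorem. -/
noncomputable def fourier [NeZero p] (f : L2 p) : L2 p :=
  if h : ∃ F : L2 p, IsFourierTransform f F then h.choose else 0

/-- The translation `T_h f (x) = f (x - h)` on `L²`. -/
noncomputable def translate [NeZero p] (h : Vilenkin p) (f : L2 p) : L2 p :=
  Lp.compMeasurePreserving (fun x => x - h) (measurePreserving_sub_right (haar p) h) f

theorem memLp_comp_A [NeZero p] (f : L2 p) : MemLp (fun x => f (A p x)) 2 (haar p) := by
  have hc := addEquivAddHaarChar_smul_map (haar p) (A p)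
  have hpos := addEquivAddHaarChar_pos (A p)
  have hmap : (haar p).map (A p) = (addEquivAddHaarChar (A p))⁻¹ • haar p := by
    conv_rhs => rw [← hc]
    rw [smul_smul, inv_mul_cancel₀ hpos.ne', one_smul]
  have h1 : MemLp f 2 ((haar p).map (A p)) := by
    rw [hmap]
    exact (Lp.memLp f).smul_measure (c := ((addEquivAddHaarChar (A p))⁻¹ : NNReal))
      ENNReal.coe_ne_top
  exact h1.comp_of_map (A p).continuous.measurable.aemeasurable

/-- The map `f ↦ f (A ·)` on `L²`. -/
noncomputable def compA [NeZero p] (f : L2 p) : L2 p := (memLp_comp_A f).toLp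

/-- The bracket `[f, g] (x) = ∑_{h ∈ H} f (x + h) * conj (g (x + h))`. -/
noncomputable def bracket (f g : Vilenkin p → ℂ) (x : Vilenkin p) : ℂ :=
  ∑' h : H p, f (x + h) * conj (g (x + h))

/-- The periodization `P_φ (ω) = ∑_h |φ̂ (ω + h)|²` over the annihilator of `H`. -/
noncomputable def periodization [NeZero p] (φ : L2 p) (ω : Vilenkin p) : ℝ :=
  ∑' h : H p, ‖fourier φ (ω + h)‖ ^ 2

/-- The set `E_φ` where the periodization does not vanish. -/
def E [NeZero p] (φ : L2 p) : Set (Vilenkin p) := {ω | periodization φ ω ≠ 0}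

/-- The family `u` lies in the subspace `K` and is a frame for `K` with bounds `a` and `b`. -/
def IsFrameWithBounds {ι X : Type*} [NormedAddCommGroup X] [InnerProductSpace ℂ X] (a b : ℝ)
    (K : Submodule ℂ X) (u : ι → X) : Prop :=
  0 < a ∧ a ≤ b ∧ (∀ i, u i ∈ K) ∧ ∀ g ∈ K,
    Summable (fun i => ‖inner ℂ (u i) g‖ ^ 2) ∧
    a * ‖g‖ ^ 2 ≤ ∑' i, ‖inner ℂ (u i) g‖ ^ 2 ∧
    ∑' i, ‖inner ℂ (u i) g‖ ^ 2 ≤ b * ‖g‖ ^ 2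

/-- `V` is a frame multiresolution analysis of `L²` with scaling function `φ`. -/
structure IsFMRA [NeZero p] (V : ℤ → Submodule ℂ (L2 p)) (φ : L2 p) : Prop where
  isClosed : ∀ j, IsClosed (V j : Set (L2 p))
  le_succ : ∀ j, V j ≤ V (j + 1)
  mem_iff : ∀ j, ∀ f : L2 p, f ∈ V j ↔ compA f ∈ V (j + 1)
  closure_iUnion : closure (⋃ j, (V j : Set (L2 p))) = Set.univ
  iInter_eq : ⋂ j, (V j : Set (L2 p)) = {0}
  scaling_mem : φ ∈ V 0
  frame : ∃ a b : ℝ, IsFrameWithBounds a b (V 0) (fun h : H p => translate (h : Vilenkin p) φ)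

/-- `V` is a Parseval frame multiresolution analysis of `L²` with scaling function `φ`. -/
structure IsParsevalFMRA [NeZero p] (V : ℤ → Submodule ℂ (L2 p)) (φ : L2 p) : Prop
    extends IsFMRA V φ where
  parseval : IsFrameWithBounds 1 1 (V 0) (fun h : H p => translate (h : Vilenkin p) φ)

/-- The minimal low-pass filter `m_φ = [φ̂ (B ·), φ̂]`, a function on the whole dual group that is
periodic with respect to the annihilator of `H`. -/
noncomputable def lowPass [NeZero p] (φ : L2 p) : Vilenkin p → ℂ :=
  bracket (fun ω => fourier φ (A p ω)) (fourier φ)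

end Vilenkin

/-! The heart is `bracket_fourier_self`: for every f in V_0, [f̂, f̂] = |[f̂, φ̂]|² almost
everywhere. The numbers ⟨f, T_h φ⟩ are the Fourier coefficients on U_0 of the H^⊥-periodic function
[f̂, φ̂]. The Parseval property says that f ↦ (⟨f, T_h φ⟩)_h is an isometry, so f ↦ [f̂, φ̂] is an
isometry of V_0 into L²(U_0) (`coeFn_bracketL`). It turns T_k into multiplication by a character, so
preservation of the inner product of f with T_k f for every k in H says that |[f̂, φ̂]|² and [f̂,
f̂] have the same Fourier coefficients.

Two choices of f suffice. With f = φ the periodization P satisfies P = P², hence P is the indicator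
of E_φ. With f = φ(A⁻¹ ·), which lies in V_{-1} ⊆ V_0 and has transform a constant times φ̂(B ·),
the identity becomes |m_φ(ω)|² = ∑_h |φ̂(B(ω ⊕ h))|². The sets B(0.ζ ⊕ H^⊥) partition H^⊥, so
summing over ζ gives P(Bω).

The analytic groundwork is Fourier series on the compact groups U_k
(`ae_eq_zero_of_fourierCoeff_eq_zero`, `tsum_enorm_fourierCoeff_sq`) and Plancherel's theorem,
deduced from them by truncation to U_{-n} (`eLpNorm_truncFourier`). -/

namespace Vilenkin

variable {p : ℕ}

/-! ### The pairing and its annihilators -/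

/-- The subgroup of the sequences with `x j = 0` for all `j > k`. -/
def HAbove (p : ℕ) (k : ℤ) : AddSubgroup (Vilenkin p) where
  carrier := {x | ∀ j > k, x j = 0}
  zero_mem' := fun _ _ => rfl
  add_mem' := fun {x y} hx hy j hj => by simp [hx j hj, hy j hj]
  neg_mem' := fun {x} hx j hj => by simp [hx j hj]

theorem HAbove_zero : HAbove p 0 = H p := rfl

theorem finite_support_mul (x ω : Vilenkin p) :
    (Function.support fun j : ℤ => x j * ω (1 - j)).Finite := by
  obtain ⟨k, hk⟩ := x.exists_bound
  obtain ⟨l, hl⟩ := ω.exists_bound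
  refine (Set.finite_Icc k (1 - l)).subset fun j hj => ?_
  by_contra h
  rw [Set.mem_Icc, not_and_or, not_le, not_le] at h
  apply hj
  rcases h with h | h
  · simp [hk j h]
  · simp [hl (1 - j) (by lia)]

theorem char_add_left [NeZero p] (x y ω : Vilenkin p) :
    char (x + y) ω = char x ω * char y ω := by
  unfold char
  rw [← AddChar.map_add_eq_mul, ← finsum_add_distrib (finite_support_mul x ω)
    (finite_support_mul y ω)]
  simp only [add_apply, add_mul]

theorem char_comm [NeZero p] (x ω : Vilenkin p) : char x ω = char ω x := by
  unfold char
  congr 1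
  rw [← finsum_comp_equiv (Equiv.subLeft (1 : ℤ))]
  refine finsum_congr fun j => ?_
  simp [mul_comm]

theorem char_add_right [NeZero p] (x ω η : Vilenkin p) :
    char x (ω + η) = char x ω * char x η := by
  rw [char_comm, char_add_left, char_comm ω, char_comm η]

@[simp] theorem char_zero_left [NeZero p] (ω : Vilenkin p) : char 0 ω = 1 := by
  simp [char]

@[simp] theorem norm_char [NeZero p] (x ω : Vilenkin p) : ‖char x ω‖ = 1 := by
  simp [char]

theorem conj_char_mul_char [NeZero p] (x ω : Vilenkin p) : conj (char x ω) * char x ω = 1 := by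
  rw [mul_comm, Complex.mul_conj, Complex.normSq_eq_norm_sq]
  simp

theorem char_neg_left [NeZero p] (x ω : Vilenkin p) : char (-x) ω = conj (char x ω) := by
  have h : char (-x) ω * char x ω = 1 := by rw [← char_add_left]; simp
  have h0 : char x ω ≠ 0 := by
    intro h0
    simpa [h0] using norm_char x ω
  exact mul_right_cancel₀ h0 (h.trans (conj_char_mul_char x ω).symm)

/-- In each term x_j ω_{1-j} one factor vanishes, since j > k means 1 - j ≤ -k. Characters of U_k
therefore depend only on ω modulo U_{-k}, and the complement `HAbove p (-k)` serves as their index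
set below. -/
theorem char_eq_one_of_mem_U [NeZero p] {k : ℤ} {x ω : Vilenkin p} (hx : x ∈ U p k)
    (hω : ω ∈ U p (-k)) : char x ω = 1 := by
  have : ∀ j : ℤ, x j * ω (1 - j) = 0 := fun j => by
    rcases le_or_gt j k with h | h
    · simp [hx j h]
    · simp [hω (1 - j) (by lia)]
  simp [char, this]

theorem char_eq_one_of_mem_HAbove [NeZero p] {k : ℤ} {x ω : Vilenkin p} (hx : x ∈ HAbove p k)
    (hω : ω ∈ HAbove p (-k)) : char x ω = 1 := by
  have : ∀ j : ℤ, x j * ω (1 - j) = 0 := fun j => by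
    rcases le_or_gt j k with h | h
    · simp [hω (1 - j) (by lia)]
    · simp [hx j h]
  simp [char, this]

theorem char_eq_one_of_mem_H [NeZero p] {x ω : Vilenkin p} (hx : x ∈ H p) (hω : ω ∈ H p) :
    char x ω = 1 :=
  char_eq_one_of_mem_HAbove (k := 0) hx (by simpa [HAbove_zero] using hω)

/-- The shift is its own transpose, because the two indices of the pairing have constant sum. -/
theorem char_A [NeZero p] (x ω : Vilenkin p) : char (A p x) ω = char x (A p ω) := by
  unfold char
  congr 1
  rw [← finsum_comp_equiv (Equiv.addRight (1 : ℤ))]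
  conv_rhs => rw [← finsum_comp_equiv (Equiv.addRight (1 : ℤ)),
    ← finsum_comp_equiv (Equiv.addRight (1 : ℤ))]
  refine finsum_congr fun j => ?_
  simp only [A_apply, Equiv.coe_addRight]
  congr 2
  lia

/-- The element whose coordinate at `j` is `1` and whose other coordinates are zero. -/
def single (p : ℕ) (j : ℤ) : Vilenkin p :=
  mk (Pi.single j 1) ⟨j, fun _ hi => Pi.single_eq_of_ne hi.ne _⟩

theorem char_single [NeZero p] (j : ℤ) (ω : Vilenkin p) :
    char (single p (1 - j)) ω = ZMod.stdAddChar (ω j) := by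
  unfold char
  rw [finsum_eq_single _ (1 - j) fun i hi => ?_]
  · simp [single]
  · simp [single, Pi.single_eq_of_ne hi]

theorem char_single_ne_one [NeZero p] {j : ℤ} {ω : Vilenkin p} (h : ω j ≠ 0) :
    char (single p (1 - j)) ω ≠ 1 := by
  rw [char_single]
  intro h1
  exact h (ZMod.injective_stdAddChar (by simpa using h1))

theorem single_mem_U {j k : ℤ} (h : k < j) : single p j ∈ U p k := fun i hi => by
  simp [single, Pi.single_eq_of_ne (show i ≠ j by lia)]

theorem single_mem_HAbove {j k : ℤ} (h : j ≤ k) : single p j ∈ HAbove p k := fun i hi => by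
  simp [single, Pi.single_eq_of_ne (show i ≠ j by lia)]

theorem continuous_char_left [NeZero p] (ω : Vilenkin p) : Continuous fun x => char x ω := by
  refine continuous_iff_continuousAt.2 fun x s hs => ?_
  obtain ⟨k, hk⟩ := ω.exists_bound
  refine mem_nhds_iff.2 ⟨-(k - 1), fun y hy => ?_⟩
  have : char y ω = char x ω := by
    rw [← sub_add_cancel y x, char_add_left, char_eq_one_of_mem_U hy, one_mul]
    rw [neg_neg]
    exact fun j hj => hk j (by lia)
  change char y ω ∈ s
  rw [this]
  exact mem_of_mem_nhds hs

theorem continuous_char_right [NeZero p] (x : Vilenkin p) : Continuous fun ω => char x ω := by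
  simpa only [char_comm x] using continuous_char_left x

/-! ### Cosets of U_k: topology and Haar measure -/

theorem isOpen_U (k : ℤ) : IsOpen (U p k : Set (Vilenkin p)) :=
  isOpen_iff_mem_nhds.2 fun x hx => mem_nhds_iff.2 ⟨k, fun y hy => by
    simpa using (U p k).add_mem hy hx⟩

theorem U_anti {k l : ℤ} (h : k ≤ l) : U p l ≤ U p k := fun _ hx j hj => hx j (hj.trans h)

theorem measurableSet_U (k : ℤ) : MeasurableSet (U p k : Set (Vilenkin p)) :=
  (isOpen_U k).measurableSet

theorem exists_mem_U (x : Vilenkin p) : ∃ k : ℤ, x ∈ U p k := by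
  obtain ⟨k, hk⟩ := x.exists_bound
  exact ⟨k - 1, fun j hj => hk j (by lia)⟩

theorem exists_HAbove_sub_mem_U (k : ℤ) (x : Vilenkin p) : ∃ h ∈ HAbove p k, x - h ∈ U p k := by
  obtain ⟨l, hl⟩ := x.exists_bound
  refine ⟨mk (fun j => if j ≤ k then x j else 0) ⟨l, fun j hj => by simp [hl j hj]⟩,
    fun j hj => ?_, fun j hj => ?_⟩
  · simp [not_le.2 hj]
  · simp [hj]

theorem eq_zero_of_mem_U_of_mem_HAbove {k : ℤ} {x : Vilenkin p} (h : x ∈ U p k)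
    (h' : x ∈ HAbove p k) : x = 0 :=
  ext fun j => (le_or_gt j k).elim (h j) (h' j)

/-- The coordinates of an element of `HAbove p k`, as a finitely supported function. -/
noncomputable def finsuppOfHAbove {k : ℤ} (x : HAbove p k) : ℤ →₀ ZMod p :=
  Finsupp.ofSupportFinite (x : Vilenkin p) (by
    obtain ⟨l, hl⟩ := (x : Vilenkin p).exists_bound
    refine (Set.finite_Icc l k).subset fun j hj => ?_
    by_contra h
    rw [Set.mem_Icc, not_and_or, not_le, not_le] at h
    exact hj (h.elim (hl j) (x.2 j)))

theorem finsuppOfHAbove_injective (k : ℤ) :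
    Function.Injective (finsuppOfHAbove : HAbove p k → ℤ →₀ ZMod p) := fun x y hxy =>
  Subtype.ext (ext fun j => by
    exact DFunLike.congr_fun hxy j)

instance [NeZero p] (k : ℤ) : Countable (HAbove p k) :=
  (finsuppOfHAbove_injective k).countable

instance [NeZero p] : Countable (H p) := inferInstanceAs (Countable (HAbove p 0))

instance [NeZero p] (k l : ℤ) : Finite ↥(U p k ⊓ HAbove p l) := by
  let r : ↥(U p k ⊓ HAbove p l) → (Set.Ioc k l → ZMod p) := fun x j => (x : Vilenkin p) j
  refine Finite.of_injective r fun x y hxy => Subtype.ext (ext fun j => ?_)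
  by_cases hj : j ∈ Set.Ioc k l
  · exact congrFun hxy ⟨j, hj⟩
  · rw [Set.mem_Ioc, not_and_or, not_lt, not_le] at hj
    rcases hj with hj | hj
    · rw [x.2.1 j hj, y.2.1 j hj]
    · rw [x.2.2 j hj, y.2.2 j hj]

/-- The coset `a + U_m`. -/
def ball (a : Vilenkin p) (m : ℤ) : Set (Vilenkin p) := {x | x - a ∈ U p m}

theorem isOpen_ball (a : Vilenkin p) (m : ℤ) : IsOpen (ball a m) :=
  (isOpen_U m).preimage (continuous_id.sub continuous_const)

theorem ball_eq_of_mem {a b : Vilenkin p} {m : ℤ} (h : b ∈ ball a m) : ball b m = ball a m := by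
  ext x
  refine ⟨fun hx => ?_, fun hx => ?_⟩
  · simpa [ball] using (U p m).add_mem hx h
  · simpa [ball] using (U p m).sub_mem hx h

theorem ball_anti (a : Vilenkin p) {m n : ℤ} (h : m ≤ n) : ball a n ⊆ ball a m :=
  fun _ hx => U_anti h hx

/-- Small cosets already form a basis. The restriction m ≥ k makes each of them lie inside U_k or
miss it, which `setIntegral_ball_eq_zero` relies on. -/
theorem isTopologicalBasis_ball (k : ℤ) :
    TopologicalSpace.IsTopologicalBasis {s : Set (Vilenkin p) | ∃ a, ∃ m ≥ k, s = ball a m} := by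
  refine TopologicalSpace.isTopologicalBasis_of_isOpen_of_nhds ?_ fun a u ha hu => ?_
  · rintro _ ⟨a, m, -, rfl⟩
    exact isOpen_ball a m
  · obtain ⟨l, hl⟩ := mem_nhds_iff.1 (hu.mem_nhds ha)
    refine ⟨ball a (max k l), ⟨a, _, le_max_left _ _, rfl⟩, ?_, fun y hy => hl y ?_⟩
    · simp [ball, (U p (max k l)).zero_mem]
    · exact U_anti (le_max_right _ _) hy

theorem isPiSystem_ball (k : ℤ) :
    IsPiSystem {s : Set (Vilenkin p) | ∃ a, ∃ m ≥ k, s = ball a m} := by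
  rintro _ ⟨a, m, hm, rfl⟩ _ ⟨b, n, hn, rfl⟩ ⟨x, hxa, hxb⟩
  refine ⟨x, max m n, hm.trans (le_max_left _ _), ?_⟩
  rw [← ball_eq_of_mem hxa, ← ball_eq_of_mem hxb]
  rcases le_total m n with h | h
  · rw [max_eq_right h, Set.inter_eq_right]
    exact ball_anti x h
  · rw [max_eq_left h, Set.inter_eq_left]
    exact ball_anti x h

instance [NeZero p] : SecondCountableTopology (Vilenkin p) := by
  refine (isTopologicalBasis_ball (p := p) 0).secondCountableTopology ?_
  refine (Set.countable_range
    fun q : (Σ m : ℤ, HAbove p m) => ball (q.2 : Vilenkin p) q.1).mono ?_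
  rintro _ ⟨a, m, -, rfl⟩
  obtain ⟨h, hh, hah⟩ := exists_HAbove_sub_mem_U m a
  exact ⟨⟨m, h, hh⟩, (ball_eq_of_mem hah).symm⟩

theorem measurableSpace_eq_generateFrom_ball [NeZero p] (k : ℤ) :
    (inferInstance : MeasurableSpace (Vilenkin p)) =
      MeasurableSpace.generateFrom {s : Set (Vilenkin p) | ∃ a, ∃ m ≥ k, s = ball a m} :=
  (isTopologicalBasis_ball k).borel_eq_generateFrom

instance [NeZero p] (k : ℤ) : IsFiniteMeasure ((haar p).restrict (U p k)) :=
  ⟨by simpa using (isCompact_U k).measure_lt_top⟩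

theorem A_mem_U_iff {k : ℤ} {x : Vilenkin p} : A p x ∈ U p (k - 1) ↔ x ∈ U p k := by
  refine ⟨fun hx j hj => ?_, fun hx j hj => hx (j + 1) (by lia)⟩
  have h : x (j - 1 + 1) = 0 := hx (j - 1) (by lia)
  rwa [sub_add_cancel] at h

theorem haar_U_sub_one [NeZero p] (k : ℤ) :
    haar p (U p (k - 1)) = addEquivAddHaarChar (A p) * haar p (U p k) := by
  conv_lhs => rw [← addEquivAddHaarChar_smul_map (haar p) (A p)]
  rw [Measure.smul_apply, ENNReal.smul_def, smul_eq_mul]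
  congr 1
  refine (Measure.map_apply (A p).continuous.measurable (measurableSet_U _)).trans ?_
  congr 1
  ext x
  exact A_mem_U_iff

/-- The ratio μ(U_{k-1}) / μ(U_k) is the same for all k, so it cancels in the product; its value is
never needed. -/
theorem haar_U_mul_haar_U_neg_nat [NeZero p] (n : ℕ) :
    haar p (U p n) * haar p (U p (-n)) = 1 := by
  induction n with
  | zero => simp [haar_U]
  | succ n ih =>
    have h1 := haar_U_sub_one (p := p) (n + 1)
    have h2 := haar_U_sub_one (p := p) (-n)
    rw [add_sub_cancel_right] at h1
    rw [Nat.cast_succ, neg_add', h2, ← ih, h1]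
    ring

theorem haar_U_mul_haar_U_neg [NeZero p] (k : ℤ) :
    haar p (U p k) * haar p (U p (-k)) = 1 := by
  obtain ⟨n, rfl | rfl⟩ := k.eq_nat_or_neg
  · exact haar_U_mul_haar_U_neg_nat n
  · rw [neg_neg, mul_comm]
    exact haar_U_mul_haar_U_neg_nat n

/-! ### Periodization over the discrete subgroups -/

theorem isAddFundamentalDomain_U [NeZero p] (k : ℤ) :
    IsAddFundamentalDomain (HAbove p k) (U p k : Set (Vilenkin p)) (haar p) := by
  refine .mk' (measurableSet_U k).nullMeasurableSet fun x => ?_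
  obtain ⟨h, hh, hx⟩ := exists_HAbove_sub_mem_U k x
  refine ⟨-⟨h, hh⟩, ?_, fun g hg => ?_⟩
  · change -h + x ∈ U p k
    rwa [neg_add_eq_sub]
  · refine Subtype.ext ?_
    change (g : Vilenkin p) = -h
    rw [← add_eq_zero_iff_eq_neg]
    refine eq_zero_of_mem_U_of_mem_HAbove (k := k) ?_ ((HAbove p k).add_mem g.2 hh)
    have : (g : Vilenkin p) + x ∈ U p k := hg
    convert (U p k).sub_mem this hx using 1
    abel

/-- A property invariant under `HAbove p k` holds almost everywhere as soon as it does on `U_k`. -/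
theorem ae_of_ae_restrict_U [NeZero p] (k : ℤ) {P : Vilenkin p → Prop}
    (hP : ∀ h ∈ HAbove p k, ∀ x, P x → P (x + h))
    (hae : ∀ᵐ x ∂(haar p).restrict (U p k), P x) : ∀ᵐ x ∂haar p, P x := by
  rw [ae_restrict_iff' (measurableSet_U k)] at hae
  refine (isAddFundamentalDomain_U k).measure_zero_of_invariant _ (fun g => ?_) ?_
  · ext x
    rw [Set.mem_vadd_set_iff_neg_vadd_mem]
    change ¬ P (-(g : Vilenkin p) + x) ↔ ¬ P x
    refine not_congr ⟨fun h => ?_, fun h => ?_⟩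
    · simpa using hP g g.2 _ h
    · simpa [add_comm] using hP (-g) (neg_mem g.2) _ h
  · refine measure_mono_null ?_ hae
    rintro x ⟨h1, h2⟩ h3
    exact h1 (h3 h2)

theorem lintegral_U_tsum [NeZero p] (k : ℤ) {f : Vilenkin p → ℝ≥0∞} (hf : AEMeasurable f (haar p)) :
    ∫⁻ x in U p k, ∑' h : HAbove p k, f (x + h) ∂(haar p) = ∫⁻ x, f x ∂(haar p) := by
  rw [(isAddFundamentalDomain_U k).lintegral_eq_tsum'', lintegral_tsum]
  · simp only [add_comm, AddSubgroup.vadd_def, vadd_eq_add]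
  · exact fun h => (hf.comp_quasiMeasurePreserving
      (measurePreserving_add_right (haar p) (h : Vilenkin p)).quasiMeasurePreserving).restrict

section Periodize

variable [NeZero p] {k : ℤ} {f : Vilenkin p → ℂ}

theorem lintegral_U_tsum_enorm_ne_top (hf : Integrable f (haar p)) :
    ∫⁻ x in U p k, ∑' h : HAbove p k, ‖f (x + h)‖ₑ ∂(haar p) ≠ ∞ := by
  rw [lintegral_U_tsum k (f := fun x => ‖f x‖ₑ) hf.1.enorm]
  exact hf.2.ne

theorem aestronglyMeasurable_translate (hf : Integrable f (haar p)) (h : Vilenkin p) :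
    AEStronglyMeasurable (fun x => f (x + h)) (haar p) :=
  hf.1.comp_quasiMeasurePreserving
    (measurePreserving_add_right (haar p) h).quasiMeasurePreserving

/-- The sum of the norms has finite integral over U_k, hence is finite almost everywhere there;
invariance under `HAbove p k` carries this to the whole group. -/
theorem ae_summable_translates (k : ℤ) (hf : Integrable f (haar p)) :
    ∀ᵐ x ∂haar p, Summable fun h : HAbove p k => ‖f (x + h)‖ := by
  refine ae_of_ae_restrict_U k (fun h hh x hx => ?_) ?_
  · refine ((Equiv.addLeft (⟨h, hh⟩ : HAbove p k)).summable_iff.2 hx).congr fun g => ?_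
    simp [add_assoc]
  · have hm : AEMeasurable (fun x => ∑' h : HAbove p k, ‖f (x + h)‖ₑ)
        ((haar p).restrict (U p k)) :=
      AEMeasurable.tsum fun h => (aestronglyMeasurable_translate hf h).enorm.restrict
    filter_upwards [ae_lt_top' hm (lintegral_U_tsum_enorm_ne_top hf)] with x hx
    have := ENNReal.summable_toReal hx.ne
    simpa using this

theorem integral_U_tsum (k : ℤ) (hf : Integrable f (haar p)) :
    ∫ x in U p k, ∑' h : HAbove p k, f (x + h) ∂haar p = ∫ x, f x ∂haar p := by
  have hm (h : HAbove p k) := (aestronglyMeasurable_translate hf h).restrict (s := (U p k : Set _))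
  rw [(isAddFundamentalDomain_U k).integral_eq_tsum'' f hf, integral_tsum hm]
  · simp only [add_comm, AddSubgroup.vadd_def, vadd_eq_add]
  · rw [← lintegral_tsum fun h => (hm h).enorm]
    exact lintegral_U_tsum_enorm_ne_top hf

theorem integrableOn_U_tsum (k : ℤ) (hf : Integrable f (haar p)) :
    IntegrableOn (fun x => ∑' h : HAbove p k, f (x + h)) (U p k) (haar p) := by
  have hm (h : HAbove p k) := (aestronglyMeasurable_translate hf h).restrict (s := (U p k : Set _))
  refine ⟨(AEMeasurable.tsum fun h => (hm h).aemeasurable).aestronglyMeasurable, ?_⟩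
  refine lt_of_le_of_lt (lintegral_mono fun x => ?_) (lintegral_U_tsum_enorm_ne_top hf).lt_top
  exact enorm_tsum_le_tsum_enorm

end Periodize

/-! ### Fourier series on U_k -/

/-- Orthogonality for the finite group of coordinates in (-m, -k], which is dual to U_k / U_m. If
x_j ≠ 0 with k < j ≤ m, the unit at 1 - j lies in that group and its pairing with x is not 1. -/
theorem sum_char_eq_ite [NeZero p] {k m : ℤ} {x : Vilenkin p} (hx : x ∈ U p k)
    [Fintype ↥(U p (-m) ⊓ HAbove p (-k))] [Decidable (x ∈ U p m)] :
    ∑ h : ↥(U p (-m) ⊓ HAbove p (-k)), char x h =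
      if x ∈ U p m then (Fintype.card ↥(U p (-m) ⊓ HAbove p (-k)) : ℂ) else 0 := by
  classical
  let ψ : AddChar ↥(U p (-m) ⊓ HAbove p (-k)) ℂ :=
    { toFun := fun h => char x h
      map_zero_eq_one' := by simp [char_comm x]
      map_add_eq_mul' := fun h h' => char_add_right x h h' }
  have hψ : ψ = 0 ↔ x ∈ U p m := by
    refine ⟨fun h j hj => ?_, fun h => ?_⟩
    · by_contra hxj
      have hjk : k < j := by
        by_contra hjk
        exact hxj (hx j (not_lt.1 hjk))
      refine char_single_ne_one hxj ?_
      rw [char_comm]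
      exact DFunLike.congr_fun h (⟨single p (1 - j), single_mem_U (by lia),
        single_mem_HAbove (by lia)⟩ : ↥(U p (-m) ⊓ HAbove p (-k)))
    · exact DFunLike.ext _ _ fun g => char_eq_one_of_mem_U h g.2.1
  have := AddChar.sum_eq_ite ψ
  simp only [hψ] at this
  exact this

theorem integrable_conj_char_mul [NeZero p] {ν : Measure (Vilenkin p)} {g : Vilenkin p → ℂ}
    (hg : Integrable g ν) (h : Vilenkin p) : Integrable (fun x => conj (char x h) * g x) ν :=
  hg.bdd_mul (c := 1) (by
    have := continuous_char_left h
    exact (Complex.continuous_conj.comp this).aestronglyMeasurable) (by simp)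

/-- On U_k the indicator of a coset of U_m is a finite linear combination of characters, so
vanishing coefficients force a vanishing integral over the coset. -/
theorem setIntegral_ball_eq_zero [NeZero p] {k m : ℤ} (hkm : k ≤ m) {g : Vilenkin p → ℂ}
    (hg : IntegrableOn g (U p k) (haar p))
    (h0 : ∀ h ∈ HAbove p (-k), ∫ x in U p k, conj (char x h) * g x ∂haar p = 0)
    (a : Vilenkin p) : ∫ x in ball a m, g x ∂(haar p).restrict (U p k) = 0 := by
  classical
  have := Fintype.ofFinite ↥(U p (-m) ⊓ HAbove p (-k))
  by_cases ha : a ∈ U p k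
  · have key : ∀ x ∈ U p k, ∑ h : ↥(U p (-m) ⊓ HAbove p (-k)),
        char a h * (conj (char x h) * g x) =
        (Fintype.card ↥(U p (-m) ⊓ HAbove p (-k)) : ℂ) * (ball a m).indicator g x := by
      intro x hx
      have h1 := sum_char_eq_ite (m := m) ((U p k).sub_mem ha hx)
      have h2 : (a - x ∈ U p m) ↔ x ∈ ball a m := by
        rw [← neg_mem_iff, neg_sub]
        rfl
      simp_rw [h2] at h1
      rw [Set.indicator_apply, mul_ite, mul_zero, ← zero_mul (g x), ← ite_mul, ← h1,
        Finset.sum_mul]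
      refine Finset.sum_congr rfl fun h _ => ?_
      rw [sub_eq_add_neg, char_add_left, char_neg_left, mul_assoc]
    have h3 := setIntegral_congr_fun (μ := haar p) (measurableSet_U k) key
    rw [integral_finsetSum _ fun h _ => (integrable_conj_char_mul hg _).const_mul _,
      integral_const_mul, integral_indicator (isOpen_ball a m).measurableSet] at h3
    simp only [integral_const_mul] at h3
    rw [Finset.sum_eq_zero fun h _ => by rw [h0 _ h.2.2, mul_zero]] at h3
    exact (mul_eq_zero.1 h3.symm).resolve_left (Nat.cast_ne_zero.2 Fintype.card_ne_zero)
  · rw [Measure.restrict_restrict (isOpen_ball a m).measurableSet]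
    have : ball a m ∩ (U p k : Set (Vilenkin p)) = ∅ := by
      refine Set.eq_empty_of_forall_notMem fun x hx => ha ?_
      simpa using (U p k).sub_mem hx.2 (U_anti hkm hx.1)
    simp [this]

/-- An integrable function on `U_k` is determined by its Fourier coefficients. -/
theorem ae_eq_zero_of_fourierCoeff_eq_zero [NeZero p] {k : ℤ} {g : Vilenkin p → ℂ}
    (hg : IntegrableOn g (U p k) (haar p))
    (h0 : ∀ h ∈ HAbove p (-k), ∫ x in U p k, conj (char x h) * g x ∂haar p = 0) :
    g =ᵐ[(haar p).restrict (U p k)] 0 := by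
  refine Integrable.ae_eq_zero_of_forall_setIntegral_eq_zero hg fun s hs _ => ?_
  -- The coefficient at 0 gives the integral over all of U_k, which the complement step of the π-λ
  -- induction needs.
  have huniv : ∫ x, g x ∂(haar p).restrict (U p k) = 0 := by
    simpa [char_comm _ 0] using h0 0 (HAbove p (-k)).zero_mem
  refine MeasurableSpace.induction_on_inter
    (C := fun s _ => ∫ x in s, g x ∂(haar p).restrict (U p k) = 0)
    (measurableSpace_eq_generateFrom_ball k) (isPiSystem_ball k) (by simp) ?_ ?_ ?_ s hs
  · rintro _ ⟨a, m, hm, rfl⟩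
    exact setIntegral_ball_eq_zero hm hg h0 a
  · intro t ht ih
    have := integral_add_compl ht hg
    rwa [ih, zero_add, huniv] at this
  · intro f hd hf ih
    rw [integral_iUnion hf hd hg.integrableOn]
    simp [ih]

theorem setIntegral_U_add [NeZero p] {k : ℤ} {x₀ : Vilenkin p} (hx₀ : x₀ ∈ U p k)
    (f : Vilenkin p → ℂ) : ∫ x in U p k, f (x + x₀) ∂haar p = ∫ x in U p k, f x ∂haar p := by
  rw [← integral_indicator (measurableSet_U k), ← integral_indicator (measurableSet_U k),
    ← integral_add_right_eq_self ((U p k : Set (Vilenkin p)).indicator f) x₀]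
  congr 1 with x
  have : x + x₀ ∈ U p k ↔ x ∈ U p k := (U p k).add_mem_cancel_right hx₀
  by_cases hx : x ∈ U p k
  · simp [Set.indicator, hx, this.2 hx]
  · simp [Set.indicator, hx, mt this.1 hx]

/-- Translating by a suitable element of U_k multiplies the integral by a number other than 1. -/
theorem setIntegral_char_eq_zero [NeZero p] {k : ℤ} {h : Vilenkin p} (hh : h ∈ HAbove p (-k))
    (h0 : h ≠ 0) : ∫ x in U p k, char x h ∂haar p = 0 := by
  obtain ⟨j, hj⟩ : ∃ j, h j ≠ 0 := by
    by_contra! hc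
    exact h0 (ext hc)
  have hjk : j ≤ -k := by
    by_contra hc
    exact hj (hh j (not_le.1 hc))
  have h1 := setIntegral_U_add (single_mem_U (p := p) (show k < 1 - j by lia)) (char · h)
  simp only [char_add_left, integral_mul_const] at h1
  by_contra hne
  exact char_single_ne_one hj (mul_left_cancel₀ hne (h1.trans (mul_one _).symm))

theorem memLp_char [NeZero p] (ν : Measure (Vilenkin p)) [IsFiniteMeasure ν] (h : Vilenkin p) :
    MemLp (fun x => char x h) 2 ν :=
  .of_bound (continuous_char_left h).aestronglyMeasurable 1 (by simp)

/-- The character of index `h`, as an element of `L²(U_k)`. -/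
noncomputable def charLp [NeZero p] (k : ℤ) (h : Vilenkin p) :
    Lp ℂ 2 ((haar p).restrict (U p k)) :=
  (memLp_char _ h).toLp

theorem inner_charLp [NeZero p] (k : ℤ) (h : Vilenkin p)
    (f : Lp ℂ 2 ((haar p).restrict (U p k))) :
    inner ℂ (charLp k h) f = ∫ x in U p k, conj (char x h) * f x ∂haar p := by
  rw [L2.inner_def]
  refine integral_congr_ae ?_
  filter_upwards [(memLp_char ((haar p).restrict (U p k)) h).coeFn_toLp] with x hx
  rw [charLp, hx, RCLike.inner_apply, mul_comm]

theorem inner_charLp_charLp [NeZero p] {k : ℤ} (h h' : HAbove p (-k)) [Decidable (h = h')] :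
    inner ℂ (charLp k (h : Vilenkin p)) (charLp k h') =
      if h = h' then ((haar p).real (U p k) : ℂ) else 0 := by
  have h1 : ∀ x : Vilenkin p, conj (char x h) * char x h' = char x (h' - h : Vilenkin p) := by
    intro x
    rw [sub_eq_add_neg, char_add_right, char_comm x (-_), char_neg_left, mul_comm, char_comm x h]
  have h2 : inner ℂ (charLp k (h : Vilenkin p)) (charLp k h') =
      ∫ x in U p k, char x (h' - h : Vilenkin p) ∂haar p := by
    rw [inner_charLp]
    refine integral_congr_ae ?_
    filter_upwards [(memLp_char ((haar p).restrict (U p k)) (h' : Vilenkin p)).coeFn_toLp]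
      with x hx
    rw [charLp, hx, h1]
  rw [h2]
  split_ifs with hh
  · simp [hh, char_comm _ 0, measureReal_def]
  · refine setIntegral_char_eq_zero ((HAbove p (-k)).sub_mem h'.2 h.2) ?_
    rw [sub_ne_zero]
    exact fun hc => hh (Subtype.ext hc.symm)

/-- The normalizing factor of the characters in `L²(U_k)`. -/
noncomputable def charScale (p : ℕ) [NeZero p] (k : ℤ) : ℝ := (√((haar p).real (U p k)))⁻¹

theorem haar_real_U_pos [NeZero p] (k : ℤ) : 0 < (haar p).real (U p k) := by
  have h := haar_U_mul_haar_U_neg (p := p) k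
  refine ENNReal.toReal_pos (fun h0 => ?_) (isCompact_U k).measure_lt_top.ne
  simp [h0] at h

theorem charScale_sq [NeZero p] (k : ℤ) : charScale p k ^ 2 * (haar p).real (U p k) = 1 := by
  rw [charScale, inv_pow, Real.sq_sqrt (haar_real_U_pos k).le,
    inv_mul_cancel₀ (haar_real_U_pos k).ne']

theorem orthonormal_charLp [NeZero p] (k : ℤ) :
    Orthonormal ℂ fun h : HAbove p (-k) => (charScale p k : ℂ) • charLp k (h : Vilenkin p) := by
  classical
  rw [orthonormal_iff_ite]
  intro h h'
  rw [inner_smul_left, inner_smul_right, inner_charLp_charLp]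
  split_ifs with hh
  · rw [Complex.conj_ofReal, ← mul_assoc, ← sq]
    exact_mod_cast charScale_sq k
  · simp

theorem span_charLp_orthogonal [NeZero p] (k : ℤ) :
    (Submodule.span ℂ (Set.range fun h : HAbove p (-k) =>
      (charScale p k : ℂ) • charLp k (h : Vilenkin p)))ᗮ = ⊥ := by
  rw [eq_bot_iff]
  intro f hf
  rw [Submodule.mem_bot]
  refine (Lp.eq_zero_iff_ae_eq_zero).2 (ae_eq_zero_of_fourierCoeff_eq_zero
    ((Lp.memLp f).integrable one_le_two) fun h hh => ?_)
  have h1 := (Submodule.mem_orthogonal _ _).1 hf _ (Submodule.subset_span ⟨⟨h, hh⟩, rfl⟩)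
  rw [inner_smul_left, inner_charLp, mul_eq_zero] at h1
  refine h1.resolve_left fun h2 => ?_
  have := charScale_sq (p := p) k
  simp only [map_eq_zero, Complex.ofReal_eq_zero] at h2
  simp [h2] at this

/-- The normalized characters as a Hilbert basis of `L²(U_k)`. -/
noncomputable def charBasis (p : ℕ) [NeZero p] (k : ℤ) :
    HilbertBasis (HAbove p (-k)) ℂ (Lp ℂ 2 ((haar p).restrict (U p k))) :=
  .mkOfOrthogonalEqBot (orthonormal_charLp k) (span_charLp_orthogonal k)

theorem charBasis_apply [NeZero p] (k : ℤ) (h : HAbove p (-k)) :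
    charBasis p k h = (charScale p k : ℂ) • charLp k (h : Vilenkin p) := by
  rw [charBasis, HilbertBasis.coe_mkOfOrthogonalEqBot]

/-- Parseval's identity on `U_k`. -/
theorem tsum_enorm_fourierCoeff_sq [NeZero p] {k : ℤ} {f : Vilenkin p → ℂ}
    (hf : MemLp f 2 ((haar p).restrict (U p k))) :
    ∑' h : HAbove p (-k), ‖∫ x in U p k, conj (char x h) * f x ∂haar p‖ₑ ^ 2 =
      haar p (U p k) * eLpNorm f 2 ((haar p).restrict (U p k)) ^ 2 := by
  have hm := haar_real_U_pos (p := p) k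
  have hs := lp.hasSum_norm (by norm_num) ((charBasis p k).repr hf.toLp)
  rw [LinearIsometryEquiv.norm_map] at hs
  have hc (h : HAbove p (-k)) : ‖(charBasis p k).repr hf.toLp h‖ ^ (2 : ℝ≥0∞).toReal =
      charScale p k ^ 2 * ‖∫ x in U p k, conj (char x h) * f x ∂haar p‖ ^ 2 := by
    have : ∫ x in U p k, conj (char x h) * (hf.toLp f : Vilenkin p → ℂ) x ∂haar p =
        ∫ x in U p k, conj (char x h) * f x ∂haar p := by
      refine integral_congr_ae ?_
      filter_upwards [hf.coeFn_toLp] with x hx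
      rw [hx]
    rw [HilbertBasis.repr_apply_apply, charBasis_apply, inner_smul_left, inner_charLp, this]
    simp [mul_pow]
  simp only [hc] at hs
  have hs' := hs.mul_left ((haar p).real (U p k))
  simp only [← mul_assoc, mul_comm _ (charScale p k ^ 2), charScale_sq, one_mul] at hs'
  have hterm (h : HAbove p (-k)) : ‖∫ x in U p k, conj (char x h) * f x ∂haar p‖ₑ ^ 2 =
      ENNReal.ofReal (‖∫ x in U p k, conj (char x h) * f x ∂haar p‖ ^ 2) := by
    rw [ENNReal.ofReal_pow (norm_nonneg _), ofReal_norm]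
  simp only [hterm]
  rw [← ENNReal.ofReal_tsum_of_nonneg (fun _ => sq_nonneg _) hs'.summable, hs'.tsum_eq,
    ENNReal.ofReal_mul hm.le, ofReal_measureReal (isCompact_U k).measure_lt_top.ne,
    Lp.norm_toLp]
  congr 1
  norm_num
  rw [ENNReal.ofReal_toReal hf.2.ne]

end Vilenkin

namespace Vilenkin

variable {p : ℕ} [NeZero p]

/-! ### The Fourier transform and Plancherel's theorem -/

theorem truncFourier_eq (f : Vilenkin p → ℂ) (n : ℕ) (ω : Vilenkin p) :
    truncFourier f n ω = ∫ x in U p (-(n : ℤ)), conj (char x ω) * f x ∂haar p := by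
  simp only [truncFourier, mul_comm]

theorem truncFourier_congr {f g : Vilenkin p → ℂ} (h : f =ᵐ[haar p] g) (n : ℕ) :
    truncFourier f n = truncFourier g n := by
  ext ω
  refine integral_congr_ae (ae_restrict_of_ae ?_)
  filter_upwards [h] with x hx
  rw [hx]

/-- U_n annihilates the domain of integration U_{-n}. Being constant on cosets of U_n, the truncated
transform is continuous, and its L² norm is a sum over `HAbove p n`. -/
theorem truncFourier_add_of_mem_U (f : Vilenkin p → ℂ) (n : ℕ) (ω : Vilenkin p) {u : Vilenkin p}
    (hu : u ∈ U p n) : truncFourier f n (ω + u) = truncFourier f n ω := by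
  refine setIntegral_congr_fun (measurableSet_U _) fun x hx => ?_
  rw [char_add_right, char_eq_one_of_mem_U (ω := u) hx (by simpa using hu), mul_one]

theorem continuous_truncFourier (f : Vilenkin p → ℂ) (n : ℕ) : Continuous (truncFourier f n) := by
  refine continuous_iff_continuousAt.2 fun x s hs => mem_nhds_iff.2 ⟨n, fun y hy => ?_⟩
  change truncFourier f n y ∈ s
  rw [← add_sub_cancel x y, truncFourier_add_of_mem_U f n x hy]
  exact mem_of_mem_nhds hs

theorem eLpNorm_two_sq {α : Type*} [MeasurableSpace α] {μ : Measure α} (f : α → ℂ) :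
    eLpNorm f 2 μ ^ 2 = ∫⁻ x, ‖f x‖ₑ ^ 2 ∂μ := by
  simpa using eLpNorm_nnreal_pow_eq_lintegral (f := f) (μ := μ) (p := 2) two_ne_zero

/-- By constancy on cosets the squared norm is μ(U_n) times the sum of the squared Fourier
coefficients of f on U_{-n}. Parseval there contributes the factor μ(U_{-n}), and μ(U_n) μ(U_{-n}) =
1. -/
theorem eLpNorm_truncFourier (f : Vilenkin p → ℂ) (n : ℕ)
    (hf : MemLp f 2 ((haar p).restrict (U p (-(n : ℤ))))) :
    eLpNorm (truncFourier f n) 2 (haar p) =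
      eLpNorm f 2 ((haar p).restrict (U p (-(n : ℤ)))) := by
  refine (ENNReal.pow_right_strictMono two_ne_zero).injective ?_
  rw [eLpNorm_two_sq, ← lintegral_U_tsum (-(-(n : ℤ)))
    ((continuous_truncFourier f n).measurable.enorm.pow_const 2).aemeasurable]
  have h1 : ∀ x ∈ U p (-(-(n : ℤ))), ∑' h : HAbove p (-(-(n : ℤ))),
      ‖truncFourier f n (x + h)‖ₑ ^ 2 = haar p (U p (-(n : ℤ))) *
        eLpNorm f 2 ((haar p).restrict (U p (-(n : ℤ)))) ^ 2 := fun x hx => by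
    rw [← tsum_enorm_fourierCoeff_sq hf]
    congr 1 with h
    rw [add_comm, truncFourier_add_of_mem_U _ _ _ (by simpa using hx), truncFourier_eq]
  rw [setLIntegral_congr_fun (measurableSet_U _) h1, setLIntegral_const, mul_right_comm,
    haar_U_mul_haar_U_neg, one_mul]

/-- The restriction to `U_{-n}`, extended by zero. -/
noncomputable def restrictLp (n : ℕ) (f : L2 p) : L2 p :=
  ((Lp.memLp f).indicator (measurableSet_U (-(n : ℤ)))).toLp

theorem coeFn_restrictLp (n : ℕ) (f : L2 p) :
    restrictLp n f =ᵐ[haar p] (U p (-(n : ℤ)) : Set (Vilenkin p)).indicator f :=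
  MemLp.coeFn_toLp _

theorem tendsto_restrictLp (f : L2 p) :
    Tendsto (fun n => restrictLp n f) atTop (𝓝 f) := by
  rw [Lp.tendsto_Lp_iff_tendsto_eLpNorm']
  have h0 : (fun n : ℕ => eLpNorm (⇑(restrictLp n f) - ⇑f) 2 (haar p) ^ 2) =
      fun n : ℕ => ∫⁻ x, ‖(U p (-(n : ℤ)) : Set (Vilenkin p))ᶜ.indicator f x‖ₑ ^ 2 ∂haar p := by
    ext n
    rw [eLpNorm_two_sq]
    refine lintegral_congr_ae ?_
    filter_upwards [coeFn_restrictLp n f] with x hx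
    rw [Pi.sub_apply, hx]
    by_cases h : x ∈ (U p (-(n : ℤ)) : Set (Vilenkin p)) <;> simp [h]
  have h1 : Tendsto (fun n : ℕ => eLpNorm (⇑(restrictLp n f) - ⇑f) 2 (haar p) ^ 2)
      atTop (𝓝 0) := by
    rw [h0, ← lintegral_zero (μ := haar p)]
    refine tendsto_lintegral_of_dominated_convergence' (fun x => ‖f x‖ₑ ^ 2) (fun n => ?_)
      (fun n => ?_) ?_ ?_
    · exact (((Lp.aestronglyMeasurable f).indicator (measurableSet_U _).compl).enorm).pow_const 2
    · refine ae_of_all _ fun x => ?_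
      exact pow_le_pow_left' (enorm_indicator_le_enorm_self _ _) 2
    · rw [← eLpNorm_two_sq]
      exact ENNReal.pow_ne_top (Lp.eLpNorm_ne_top f)
    · refine ae_of_all _ fun x => tendsto_const_nhds.congr' ?_
      obtain ⟨k, hk⟩ := exists_mem_U x
      filter_upwards [eventually_ge_atTop k.natAbs] with n hn
      have : x ∈ (U p (-(n : ℤ)) : Set (Vilenkin p)) := U_anti (by lia) hk
      simp [this]
  have h2 := (ENNReal.continuous_rpow_const (y := (2 : ℝ)⁻¹)).continuousAt.tendsto.comp h1
  rw [ENNReal.zero_rpow_of_pos (by norm_num)] at h2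
  refine h2.congr fun n => ?_
  rw [Function.comp_apply, ← ENNReal.rpow_natCast, ← ENNReal.rpow_mul]
  norm_num

theorem memLp_truncFourier (f : L2 p) (n : ℕ) : MemLp (truncFourier f n) 2 (haar p) :=
  ⟨(continuous_truncFourier f n).aestronglyMeasurable, by
    rw [eLpNorm_truncFourier _ _ ((Lp.memLp f).restrict _)]
    exact ((Lp.memLp f).restrict _).2⟩

theorem integrable_conj_char_mul_restrict (f : L2 p) (n : ℕ) (ω : Vilenkin p) :
    IntegrableOn (fun x => conj (char x ω) * f x) (U p (-(n : ℤ))) (haar p) :=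
  integrable_conj_char_mul (((Lp.memLp f).restrict _).integrable one_le_two) ω

/-- The truncated Fourier transform as a linear operator on `L²`. -/
noncomputable def truncFourierL (p : ℕ) [NeZero p] (n : ℕ) : L2 p →ₗ[ℂ] L2 p where
  toFun f := (memLp_truncFourier f n).toLp
  map_add' f g := by
    rw [← MemLp.toLp_add]
    congr 1
    rw [truncFourier_congr (Lp.coeFn_add f g)]
    ext ω
    simp only [truncFourier_eq, Pi.add_apply, mul_add]
    exact integral_add (integrable_conj_char_mul_restrict f n ω)
      (integrable_conj_char_mul_restrict g n ω)
  map_smul' c f := by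
    rw [RingHom.id_apply, ← MemLp.toLp_const_smul]
    congr 1
    rw [truncFourier_congr (Lp.coeFn_smul c f)]
    ext ω
    simp only [truncFourier_eq, Pi.smul_apply, smul_eq_mul, mul_left_comm _ c]
    exact integral_const_mul c _

theorem coeFn_truncFourierL (n : ℕ) (f : L2 p) :
    truncFourierL p n f =ᵐ[haar p] truncFourier f n :=
  (memLp_truncFourier f n).coeFn_toLp

theorem norm_truncFourierL (n : ℕ) (f : L2 p) : ‖truncFourierL p n f‖ = ‖restrictLp n f‖ := by
  change ‖(memLp_truncFourier f n).toLp (truncFourier f n)‖ = ‖restrictLp n f‖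
  rw [Lp.norm_toLp _ (memLp_truncFourier f n), restrictLp, Lp.norm_toLp,
    eLpNorm_truncFourier _ _ ((Lp.memLp f).restrict _),
    eLpNorm_indicator_eq_eLpNorm_restrict (measurableSet_U _)]

theorem norm_restrictLp_le (n : ℕ) (f : L2 p) : ‖restrictLp n f‖ ≤ ‖f‖ := by
  rw [restrictLp, Lp.norm_toLp, Lp.norm_def]
  exact ENNReal.toReal_mono (Lp.eLpNorm_ne_top f) (eLpNorm_indicator_le _)

theorem truncFourierL_restrictLp {m n : ℕ} (h : m ≤ n) (f : L2 p) :
    truncFourierL p n (restrictLp m f) = truncFourierL p m f := by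
  refine Lp.ext ((coeFn_truncFourierL _ _).trans (EventuallyEq.trans ?_
    (coeFn_truncFourierL _ _).symm))
  rw [truncFourier_congr (coeFn_restrictLp m f)]
  refine ae_of_all _ fun ω => ?_
  have hsub : (U p (-(m : ℤ)) : Set (Vilenkin p)) ⊆ U p (-(n : ℤ)) := U_anti (by lia)
  simp only [truncFourier]
  rw [← integral_indicator (measurableSet_U _), ← integral_indicator (measurableSet_U _)]
  congr 1 with x
  by_cases hx : x ∈ (U p (-(m : ℤ)) : Set (Vilenkin p))
  · simp [hx, hsub hx]
  · simp [hx]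

/-- For n ≥ N, truncating at N is the same as applying the n-th transform to f restricted to U_{-N}.
The difference of the two transforms thus has norm at most that of the discarded tail of f. -/
theorem cauchySeq_truncFourierL (f : L2 p) : CauchySeq fun n => truncFourierL p n f := by
  have h0 := tendsto_iff_norm_sub_tendsto_zero.1 (tendsto_restrictLp f)
  refine cauchySeq_of_le_tendsto_0 (fun n => 2 * ‖restrictLp n f - f‖) (fun n m N hn hm => ?_)
    (by simpa using h0.const_mul 2)
  have key : ∀ n, N ≤ n →
      ‖truncFourierL p n f - truncFourierL p N f‖ ≤ ‖restrictLp N f - f‖ := fun n hn => by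
    rw [← truncFourierL_restrictLp hn, ← map_sub, norm_sub_rev (restrictLp N f)]
    exact (norm_truncFourierL _ _).trans_le (norm_restrictLp_le _ _)
  rw [two_mul]
  refine (dist_triangle_right _ _ (truncFourierL p N f)).trans ?_
  rw [dist_eq_norm, dist_eq_norm]
  exact add_le_add (key n hn) (key m hm)

theorem isFourierTransform_iff {f F : L2 p} :
    IsFourierTransform f F ↔ Tendsto (fun n => truncFourierL p n f) atTop (𝓝 F) := by
  rw [Lp.tendsto_Lp_iff_tendsto_eLpNorm', IsFourierTransform]
  refine iff_of_eq (congrArg (Tendsto · atTop (𝓝 0)) (funext fun n => ?_))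
  rw [← eLpNorm_neg]
  refine eLpNorm_congr_ae ?_
  filter_upwards [coeFn_truncFourierL n f] with ω hω
  simp [hω]

theorem isFourierTransform_fourier (f : L2 p) : IsFourierTransform f (fourier f) := by
  have h : ∃ F : L2 p, IsFourierTransform f F := by
    obtain ⟨F, hF⟩ := cauchySeq_tendsto_of_complete (cauchySeq_truncFourierL f)
    exact ⟨F, isFourierTransform_iff.2 hF⟩
  rw [fourier, dif_pos h]
  exact h.choose_spec

theorem IsFourierTransform.eq_fourier {f F : L2 p} (h : IsFourierTransform f F) :
    fourier f = F :=
  tendsto_nhds_unique (isFourierTransform_iff.1 (isFourierTransform_fourier f))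
    (isFourierTransform_iff.1 h)

theorem tendsto_truncFourierL (f : L2 p) :
    Tendsto (fun n => truncFourierL p n f) atTop (𝓝 (fourier f)) :=
  isFourierTransform_iff.1 (isFourierTransform_fourier f)

/-- The Fourier transform as a linear isometry of `L²`. -/
noncomputable def fourierL (p : ℕ) [NeZero p] : L2 p →ₗᵢ[ℂ] L2 p where
  toFun := fourier
  map_add' f g := (isFourierTransform_iff.2 (by
    simpa only [map_add] using (tendsto_truncFourierL f).add (tendsto_truncFourierL g))).eq_fourier
  map_smul' c f := (isFourierTransform_iff.2 (by
    simpa only [map_smul, RingHom.id_apply] using (tendsto_truncFourierL f).const_smul c)).eq_fourier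
  norm_map' f := by
    refine tendsto_nhds_unique (tendsto_truncFourierL f).norm ?_
    simp only [norm_truncFourierL]
    exact (tendsto_restrictLp f).norm

/-- Plancherel's theorem. -/
theorem inner_fourier (f g : L2 p) : inner ℂ (fourier f) (fourier g) = inner ℂ f g :=
  (fourierL p).inner_map_map f g

/-! ### Translation and dilation under the Fourier transform -/

theorem coeFn_translate (h : Vilenkin p) (f : L2 p) :
    translate h f =ᵐ[haar p] fun x => f (x - h) :=
  Lp.coeFn_compMeasurePreserving _ _

theorem truncFourier_translate (f : L2 p) {h : Vilenkin p} {n : ℕ} (hn : h ∈ U p (-(n : ℤ)))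
    (ω : Vilenkin p) :
    truncFourier (translate h f) n ω = conj (char h ω) * truncFourier f n ω := by
  rw [truncFourier_congr (coeFn_translate h f), truncFourier, ← setIntegral_U_add hn,
    truncFourier_eq, ← integral_const_mul]
  congr 1 with x
  rw [add_sub_cancel_right, char_add_left, map_mul]
  ring

theorem memLp_conj_char_mul (h : Vilenkin p) (f : L2 p) :
    MemLp (fun ω => conj (char h ω) * f ω) 2 (haar p) := by
  refine (Lp.memLp f).of_le ?_ (by simp)
  exact (Complex.continuous_conj.comp (continuous_char_right h)).aestronglyMeasurable.mul
    (Lp.aestronglyMeasurable f)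

/-- The formula is exact for the truncated transforms once U_{-n} contains h, since translation by h
then preserves the domain of integration. -/
theorem fourier_translate (h : Vilenkin p) (f : L2 p) :
    fourier (translate h f) =ᵐ[haar p] fun ω => conj (char h ω) * fourier f ω := by
  have key : IsFourierTransform (translate h f) (memLp_conj_char_mul h (fourier f)).toLp := by
    refine (isFourierTransform_fourier f).congr' ?_
    obtain ⟨k, hk⟩ := exists_mem_U h
    filter_upwards [eventually_ge_atTop k.natAbs] with n hn
    have hn' : h ∈ U p (-(n : ℤ)) := U_anti (by lia) hk
    refine eLpNorm_congr_norm_ae ?_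
    filter_upwards [(memLp_conj_char_mul h (fourier f)).coeFn_toLp] with ω hω
    rw [hω, truncFourier_translate f hn', ← mul_sub, norm_mul]
    simp
  rw [key.eq_fourier]
  exact MemLp.coeFn_toLp _

theorem map_A_haar :
    (haar p).map (A p) = (addEquivAddHaarChar (A p))⁻¹ • haar p := by
  conv_rhs => rw [← addEquivAddHaarChar_smul_map (haar p) (A p)]
  rw [smul_smul, inv_mul_cancel₀ (addEquivAddHaarChar_pos (A p)).ne', one_smul]

theorem quasiMeasurePreserving_A : Measure.QuasiMeasurePreserving (A p) (haar p) (haar p) :=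
  ⟨(A p).continuous.measurable, by
    rw [map_A_haar]
    exact Measure.AbsolutelyContinuous.rfl.smul_left _⟩

theorem coeFn_compA (f : L2 p) : compA f =ᵐ[haar p] fun x => f (A p x) :=
  MemLp.coeFn_toLp _

/-- The factor by which `A` scales the Haar measure. -/
noncomputable def scaleA (p : ℕ) [NeZero p] : ℂ := ((addEquivAddHaarChar (A p) : ℝ) : ℂ)

theorem scaleA_ne_zero : scaleA p ≠ 0 := by
  simpa [scaleA] using (addEquivAddHaarChar_pos (A p)).ne'

theorem scaleA_mul_integral_comp_A (g : Vilenkin p → ℂ) :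
    scaleA p * ∫ x, g (A p x) ∂haar p = ∫ x, g x ∂haar p := by
  have h1 : ∫ x, g x ∂(haar p).map (A p) = ∫ x, g (A p x) ∂haar p :=
    (A p).toHomeomorph.measurableEmbedding.integral_map g
  rw [← h1, map_A_haar, integral_smul_nnreal_measure, NNReal.smul_def, Complex.real_smul,
    ← mul_assoc, scaleA, ← Complex.ofReal_mul, ← NNReal.coe_mul,
    mul_inv_cancel₀ (addEquivAddHaarChar_pos (A p)).ne']
  simp

theorem truncFourier_compA (f : L2 p) (n : ℕ) (ω : Vilenkin p) :
    truncFourier f (n + 1) ω = scaleA p * truncFourier (compA f) n (A p ω) := by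
  rw [truncFourier_congr (coeFn_compA f), truncFourier, truncFourier,
    ← integral_indicator (measurableSet_U _), ← integral_indicator (measurableSet_U _),
    ← scaleA_mul_integral_comp_A]
  congr 2 with x
  have h : A p x ∈ (U p (-((n + 1 : ℕ) : ℤ)) : Set (Vilenkin p)) ↔
      x ∈ (U p (-(n : ℤ)) : Set (Vilenkin p)) := by
    have := A_mem_U_iff (k := -(n : ℤ)) (x := x)
    rwa [show -(n : ℤ) - 1 = -((n + 1 : ℕ) : ℤ) by lia] at this
  classical
  rw [Set.indicator_apply, Set.indicator_apply]
  simp only [h, char_A]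

theorem eLpNorm_comp_A {g : Vilenkin p → ℂ} (hg : AEStronglyMeasurable g (haar p)) :
    eLpNorm (fun x => g (A p x)) 2 (haar p) =
      ((addEquivAddHaarChar (A p))⁻¹ ^ (2 : ℝ≥0∞).toReal⁻¹ : NNReal) * eLpNorm g 2 (haar p) := by
  have h := eLpNorm_map_measure (p := 2) (μ := haar p) (f := A p) (g := g)
    (by rw [map_A_haar]; exact hg.smul_measure _)
    (A p).continuous.measurable.aemeasurable
  rw [map_A_haar, eLpNorm_smul_measure_of_ne_zero'
    (inv_ne_zero (addEquivAddHaarChar_pos (A p)).ne')] at h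
  exact h.symm

/-- Change of variables in the truncated integrals. The constant is left unevaluated, as it is
nonzero and cancels in `IsParsevalFMRA.norm_lowPass_sq`. -/
theorem fourier_eq_fourier_compA (f : L2 p) :
    fourier f =ᵐ[haar p] fun ω => scaleA p * fourier (compA f) (A p ω) := by
  have hm := (memLp_comp_A (fourier (compA f))).const_mul (scaleA p)
  have key : IsFourierTransform f hm.toLp := by
    -- A maps U_{-n} onto U_{-(n+1)}, so level n + 1 for f matches level n for `compA f`.
    refine (tendsto_add_atTop_iff_nat 1).1 ?_
    have h0 := ENNReal.Tendsto.const_mul (a := ‖scaleA p‖ₑ *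
      ((addEquivAddHaarChar (A p))⁻¹ ^ (2 : ℝ≥0∞).toReal⁻¹ : NNReal))
      (isFourierTransform_fourier (compA f)) (Or.inr (by finiteness))
    rw [mul_zero] at h0
    refine h0.congr fun n => ?_
    have h1 := eLpNorm_comp_A ((Lp.aestronglyMeasurable (fourier (compA f))).sub
      (memLp_truncFourier (compA f) n).1)
    simp only [Pi.sub_apply] at h1
    rw [mul_assoc]
    refine (congrArg (‖scaleA p‖ₑ * ·) h1.symm).trans ?_
    rw [← eLpNorm_const_smul]
    refine eLpNorm_congr_ae ?_
    filter_upwards [hm.coeFn_toLp] with ω hω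
    rw [hω, truncFourier_compA, Pi.smul_apply, smul_eq_mul, mul_sub]
  rw [key.eq_fourier]
  exact MemLp.coeFn_toLp _

/-! ### Brackets and their Fourier coefficients -/

theorem ae_forall_translate {P : Vilenkin p → Prop} (hP : ∀ᵐ x ∂haar p, P x) (h : Vilenkin p) :
    ∀ᵐ x ∂haar p, P (x + h) :=
  (measurePreserving_add_right (haar p) h).quasiMeasurePreserving.ae hP

theorem bracket_congr_ae {f f' g g' : Vilenkin p → ℂ} (hf : f =ᵐ[haar p] f')
    (hg : g =ᵐ[haar p] g') : bracket f g =ᵐ[haar p] bracket f' g' := by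
  filter_upwards [ae_all_iff.2 fun h : H p => ae_forall_translate (hf.and hg) (h : Vilenkin p)]
    with x hx
  exact tsum_congr fun h => by rw [(hx h).1, (hx h).2]

omit [NeZero p] in
theorem bracket_add_of_mem_H (f g : Vilenkin p → ℂ) (x : Vilenkin p) {h : Vilenkin p}
    (hh : h ∈ H p) : bracket f g (x + h) = bracket f g x := by
  unfold bracket
  rw [← (Equiv.addLeft (⟨h, hh⟩ : H p)).tsum_eq fun k : H p => f (x + k) * conj (g (x + k))]
  simp [add_assoc]

theorem bracket_char_mul (f g : Vilenkin p → ℂ) {h : Vilenkin p} (hh : h ∈ H p)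
    (x : Vilenkin p) :
    bracket (fun ω => conj (char h ω) * f ω) g x = conj (char h x) * bracket f g x := by
  unfold bracket
  rw [← tsum_mul_left]
  refine tsum_congr fun k => ?_
  beta_reduce
  rw [char_add_right, char_eq_one_of_mem_H hh k.2, mul_one, mul_assoc]

omit [NeZero p] in
theorem bracket_const_mul_left (c : ℂ) (f g : Vilenkin p → ℂ) (x : Vilenkin p) :
    bracket (fun ω => c * f ω) g x = c * bracket f g x := by
  unfold bracket
  rw [← tsum_mul_left]
  exact tsum_congr fun k => by ring

omit [NeZero p] in
theorem bracket_const_mul_right (c : ℂ) (f g : Vilenkin p → ℂ) (x : Vilenkin p) :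
    bracket f (fun ω => c * g ω) x = conj c * bracket f g x := by
  unfold bracket
  rw [← tsum_mul_left]
  exact tsum_congr fun k => by rw [map_mul]; ring

omit [NeZero p] in
theorem bracket_self (f : Vilenkin p → ℂ) (x : Vilenkin p) :
    bracket f f x = ((∑' h : H p, ‖f (x + h)‖ ^ 2 : ℝ) : ℂ) := by
  rw [Complex.ofReal_tsum]
  refine tsum_congr fun h => ?_
  rw [Complex.mul_conj, Complex.normSq_eq_norm_sq]

theorem integrable_mul_conj (f g : L2 p) : Integrable (fun x => f x * conj (g x)) (haar p) :=
  L2.integrable_inner g f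

theorem integrableOn_bracket (f g : L2 p) : IntegrableOn (bracket f g) (U p 0) (haar p) :=
  integrableOn_U_tsum 0 (integrable_mul_conj f g)

theorem setIntegral_bracket (f g : L2 p) :
    ∫ x in U p 0, bracket f g x ∂haar p = inner ℂ g f :=
  (integral_U_tsum 0 (integrable_mul_conj f g)).trans (L2.inner_def g f).symm

/-- By Plancherel, translation becomes multiplication by a character that is trivial on the
annihilator of H; it leaves the periodization sum and appears as a Fourier kernel on U_0. -/
theorem inner_fourier_translate_right (f g : L2 p) {h : Vilenkin p} (hh : h ∈ H p) :
    inner ℂ g (translate h f) =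
      ∫ x in U p 0, conj (char x h) * bracket (fourier f) (fourier g) x ∂haar p := by
  rw [← inner_fourier, ← setIntegral_bracket]
  refine integral_congr_ae (ae_restrict_of_ae ?_)
  filter_upwards [bracket_congr_ae (fourier_translate h f) (ae_eq_refl (fourier g))] with x hx
  rw [hx, bracket_char_mul _ _ hh, char_comm h]

theorem translate_translate (h k : Vilenkin p) (f : L2 p) :
    translate h (translate k f) = translate (h + k) f := by
  refine Lp.ext ?_
  have h1 := ae_forall_translate (coeFn_translate k f) (-h)
  filter_upwards [coeFn_translate h (translate k f), coeFn_translate (h + k) f, h1]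
    with x hx1 hx2 hx3
  rw [hx1, hx2, sub_eq_add_neg x h, hx3]
  congr 1
  abel

theorem translate_zero (f : L2 p) : translate 0 f = f := by
  refine Lp.ext ?_
  filter_upwards [coeFn_translate 0 f] with x hx
  rw [hx, sub_zero]

/-- Translation as a linear isometry of `L²`. -/
noncomputable def translateL (h : Vilenkin p) : L2 p →ₗᵢ[ℂ] L2 p :=
  Lp.compMeasurePreservingₗᵢ ℂ (fun x => x - h) (measurePreserving_sub_right (haar p) h)

theorem translateL_apply (h : Vilenkin p) (f : L2 p) : translateL h f = translate h f := rfl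

theorem inner_translate_neg (h : Vilenkin p) (f g : L2 p) :
    inner ℂ (translate (-h) g) f = inner ℂ g (translate h f) := by
  rw [← (translateL h).inner_map_map, translateL_apply, translateL_apply, translate_translate,
    add_neg_cancel, translate_zero]

theorem inner_translate_neg_eq (f g : L2 p) {h : Vilenkin p} (hh : h ∈ H p) :
    inner ℂ (translate (-h) g) f =
      ∫ x in U p 0, conj (char x h) * bracket (fourier f) (fourier g) x ∂haar p := by
  rw [inner_translate_neg, inner_fourier_translate_right f g hh]

/-! ### Parseval frames in a Hilbert space -/

section Frame

variable {ι X : Type*} [NormedAddCommGroup X] [InnerProductSpace ℂ X] {K : Submodule ℂ X}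
  {u : ι → X}

theorem IsFrameWithBounds.comp_equiv {a b : ℝ} (h : IsFrameWithBounds a b K u) (e : ι ≃ ι) :
    IsFrameWithBounds a b K (u ∘ e) := by
  refine ⟨h.1, h.2.1, fun i => h.2.2.1 _, fun g hg => ?_⟩
  obtain ⟨h1, h2, h3⟩ := h.2.2.2 g hg
  have h4 := e.tsum_eq fun i => ‖inner ℂ (u i) g‖ ^ 2
  exact ⟨(e.summable_iff (f := fun i => ‖inner ℂ (u i) g‖ ^ 2)).2 h1, h2.trans_eq h4.symm,
    h4.trans_le h3⟩

/-- The analysis operator of a Parseval frame. -/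
noncomputable def analysis (h : IsFrameWithBounds 1 1 K u) : K →ₗᵢ[ℂ] lp (fun _ : ι => ℂ) 2 where
  toFun g := ⟨fun i => inner ℂ (u i) (g : X), memℓp_gen (by
    simpa using (h.2.2.2 g g.2).1)⟩
  map_add' f g := by
    ext i
    exact inner_add_right _ _ _
  map_smul' c f := by
    ext i
    exact inner_smul_right _ _ _
  norm_map' g := by
    obtain ⟨-, h2, h3⟩ := h.2.2.2 g g.2
    rw [one_mul] at h2 h3
    refine (sq_eq_sq₀ (norm_nonneg _) (norm_nonneg _)).1 ?_
    have h4 := lp.norm_rpow_eq_tsum (p := 2) (by norm_num)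
      (⟨fun i => inner ℂ (u i) (g : X), memℓp_gen (by simpa using (h.2.2.2 g g.2).1)⟩ :
        lp (fun _ : ι => ℂ) 2)
    simp only [ENNReal.toReal_ofNat, Real.rpow_ofNat] at h4
    exact h4.trans (le_antisymm h3 h2)

theorem analysis_apply (h : IsFrameWithBounds 1 1 K u) (g : K) (i : ι) :
    analysis h g i = inner ℂ (u i) (g : X) := rfl

/-- A vector of K orthogonal to the whole family is zero by the lower frame bound. -/
theorem IsFrameWithBounds.topologicalClosure_span [CompleteSpace X] {a b : ℝ}
    (h : IsFrameWithBounds a b K u) (hK : IsClosed (K : Set X)) :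
    (Submodule.span ℂ (Set.range u)).topologicalClosure = K := by
  have hle : Submodule.span ℂ (Set.range u) ≤ K :=
    Submodule.span_le.2 (Set.range_subset_iff.2 h.2.2.1)
  have hle' := Submodule.topologicalClosure_minimal _ hle hK
  have := (Submodule.isClosed_topologicalClosure
    (Submodule.span ℂ (Set.range u))).completeSpace_coe
  rw [← Submodule.sup_orthogonal_inf_of_hasOrthogonalProjection hle', eq_comm, sup_eq_left]
  rintro g ⟨hg, hgK⟩
  have h0 : ∀ i, inner ℂ (u i) g = 0 := fun i => (Submodule.mem_orthogonal _ _).1 hg _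
    (Submodule.le_topologicalClosure _ (Submodule.subset_span ⟨i, rfl⟩))
  have h1 := (h.2.2.2 g hgK).2.1
  simp only [h0, norm_zero, ne_eq, OfNat.ofNat_ne_zero, not_false_eq_true, zero_pow,
    tsum_zero] at h1
  have h2 : ‖g‖ ^ 2 ≤ 0 := by
    by_contra! hc
    exact absurd (mul_pos h.1 hc) h1.not_gt
  have h3 : g = 0 := by simpa using le_antisymm h2 (sq_nonneg _)
  rw [h3]
  exact Submodule.zero_mem _

theorem IsFrameWithBounds.map_mem [CompleteSpace X] {a b : ℝ} (h : IsFrameWithBounds a b K u)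
    (hK : IsClosed (K : Set X)) {T : X →ₗᵢ[ℂ] X} (hT : ∀ i, T (u i) ∈ K) {g : X} (hg : g ∈ K) :
    T g ∈ K := by
  have hle : Submodule.span ℂ (Set.range u) ≤ K.comap T.toLinearMap :=
    Submodule.span_le.2 (Set.range_subset_iff.2 hT)
  have hle' := Submodule.topologicalClosure_minimal _ hle (hK.preimage T.continuous)
  rw [h.topologicalClosure_span hK] at hle'
  exact hle' hg

end Frame

/-! ### The bracket isometry of a Parseval frame of translates -/

/-- The characters of index in `H`, as a Hilbert basis of `L²(U_0)`. -/
noncomputable def charBasisH (p : ℕ) [NeZero p] :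
    HilbertBasis (H p) ℂ (Lp ℂ 2 ((haar p).restrict (U p 0))) :=
  charBasis p 0

theorem charBasisH_apply (h : H p) : charBasisH p h = charLp 0 (h : Vilenkin p) := by
  have h1 : charScale p 0 = 1 := by simp [charScale, measureReal_def, haar_U]
  have h2 := charBasis_apply (p := p) 0 h
  rw [h1, Complex.ofReal_one, one_smul] at h2
  exact h2

section ParsevalFrame

variable {K : Submodule ℂ (L2 p)} {φ : L2 p}

theorem translate_mem_of_isFrame {a b : ℝ} (hK : IsClosed (K : Set (L2 p)))
    (h : IsFrameWithBounds a b K fun h : H p => translate (h : Vilenkin p) φ)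
    {k : Vilenkin p} (hk : k ∈ H p) {f : L2 p} (hf : f ∈ K) : translate k f ∈ K := by
  rw [← translateL_apply]
  refine h.map_mem hK (fun g => ?_) hf
  rw [translateL_apply, translate_translate]
  have h1 := h.2.2.1 (⟨k, hk⟩ + g)
  beta_reduce at h1
  rwa [AddSubgroup.coe_add] at h1

/-- The isometry of `K` into `L²(U_0)` that realizes `f ↦ [f̂, φ̂]`. -/
noncomputable def bracketL
    (h : IsFrameWithBounds 1 1 K fun h : H p => translate (h : Vilenkin p) φ) :
    K →ₗᵢ[ℂ] Lp ℂ 2 ((haar p).restrict (U p 0)) :=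
  -- The frame is reindexed by negation because, by `inner_translate_neg_eq`, the coefficient of the
  -- bracket at h is the frame coefficient against the translate by -h.
  (charBasisH p).repr.symm.toLinearIsometry.comp (analysis (h.comp_equiv (Equiv.neg (H p))))

/-- Both sides have the same Fourier coefficients. The bracket is a priori only integrable, so
uniqueness is applied in L¹; square integrability is a consequence. -/
theorem coeFn_bracketL (h : IsFrameWithBounds 1 1 K fun h : H p => translate (h : Vilenkin p) φ)
    (f : K) : bracketL h f =ᵐ[(haar p).restrict (U p 0)]
      bracket (fourier (f : L2 p)) (fourier φ) := by
  have hint : Integrable (bracketL h f) ((haar p).restrict (U p 0)) :=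
    (Lp.memLp _).integrable one_le_two
  have hb := integrableOn_bracket (fourier (f : L2 p)) (fourier φ)
  refine sub_ae_eq_zero _ _ |>.1 (ae_eq_zero_of_fourierCoeff_eq_zero (hint.sub hb)
    fun k hk => ?_)
  have hk' : k ∈ H p := hk
  simp only [Pi.sub_apply, mul_sub]
  rw [integral_sub (integrable_conj_char_mul hint k) (integrable_conj_char_mul hb k),
    ← inner_translate_neg_eq _ _ hk', ← inner_charLp, ← charBasisH_apply ⟨k, hk'⟩,
    ← HilbertBasis.repr_apply_apply]
  have : (charBasisH p).repr (bracketL h f) =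
      analysis (h.comp_equiv (Equiv.neg (H p))) f := by
    simp [bracketL]
  rw [this, analysis_apply]
  simp

theorem bracket_fourier_self (hK : IsClosed (K : Set (L2 p)))
    (h : IsFrameWithBounds 1 1 K fun h : H p => translate (h : Vilenkin p) φ)
    {f : L2 p} (hf : f ∈ K) :
    ∀ᵐ ω ∂haar p, bracket (fourier f) (fourier f) ω =
      bracket (fourier f) (fourier φ) ω * conj (bracket (fourier f) (fourier φ) ω) := by
  refine ae_of_ae_restrict_U 0 (fun k hk ω hω => ?_) ?_
  · rw [bracket_add_of_mem_H _ _ _ hk, bracket_add_of_mem_H _ _ _ hk, hω]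
  have hb := integrableOn_bracket (fourier f) (fourier f)
  set g := bracketL h ⟨f, hf⟩
  have hg := coeFn_bracketL h ⟨f, hf⟩
  have hgg : Integrable (fun ω => g ω * conj (g ω)) ((haar p).restrict (U p 0)) :=
    L2.integrable_inner g g
  have key : bracket (fourier f) (fourier f) =ᵐ[(haar p).restrict (U p 0)]
      fun ω => g ω * conj (g ω) := by
    refine sub_ae_eq_zero _ _ |>.1 (ae_eq_zero_of_fourierCoeff_eq_zero (hb.sub hgg)
      fun k hk => ?_)
    have hk' : k ∈ H p := hk
    -- K is invariant under translation by H, so the isometry applies to the pair f, T_k f.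
    -- Preservation of their inner product compares the k-th coefficients of |g|² and [f̂, f̂].
    have hkf := translate_mem_of_isFrame hK h hk' hf
    have h1 := (bracketL h).inner_map_map ⟨f, hf⟩ ⟨translate k f, hkf⟩
    rw [Submodule.coe_inner, inner_fourier_translate_right _ _ hk', L2.inner_def] at h1
    simp only [Pi.sub_apply, mul_sub]
    rw [integral_sub (integrable_conj_char_mul hb k) (integrable_conj_char_mul hgg k), ← h1,
      sub_eq_zero]
    refine integral_congr_ae ?_
    filter_upwards [hg, coeFn_bracketL h ⟨translate k f, hkf⟩,
      ae_restrict_of_ae (bracket_congr_ae (fourier_translate k f) (ae_eq_refl (fourier φ)))]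
      with ω h2 h3 h4
    rw [h3, h4, bracket_char_mul _ _ hk', RCLike.inner_apply, char_comm k, ← h2]
    ring
  filter_upwards [key, hg] with ω h1 h2
  rw [h1, h2]

end ParsevalFrame

end Vilenkin

namespace Vilenkin

variable {p : ℕ}

/-! ### Splitting H into cosets, and the filter identity -/

theorem sum_range_natCast_zmod [NeZero p] (g : ZMod p → ℝ) :
    ∑ ζ ∈ Finset.range p, g (ζ : ZMod p) = ∑ ζ : ZMod p, g ζ :=
  Finset.sum_nbij' (fun n : ℕ => (n : ZMod p)) ZMod.val (by simp)
    (fun ζ _ => Finset.mem_range.2 ζ.val_lt)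
    (fun n hn => ZMod.val_cast_of_lt (Finset.mem_range.1 hn)) (by simp) (by simp)

theorem A_frac_add_mem_H (ζ : ZMod p) (h : H p) : A p (frac p ζ + h) ∈ H p := fun j hj => by
  have h1 : (h : Vilenkin p) (j + 1) = 0 := h.2 _ (by lia)
  simp [frac, h1, hj.ne']

/-- The subgroup `H` as the union of the images under `A` of its translates by the `0.ζ`. -/
noncomputable def fracProdEquiv (p : ℕ) : ZMod p × H p ≃ H p :=
  Equiv.ofBijective (fun q => ⟨A p (frac p q.1 + q.2), A_frac_add_mem_H q.1 q.2⟩) <| by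
    constructor
    · rintro ⟨ζ, h⟩ ⟨ζ', h'⟩ hq
      have h1 : frac p ζ + h = frac p ζ' + h' := (A p).injective (Subtype.ext_iff.1 hq)
      have h2 := congrArg (fun x : Vilenkin p => x 1) h1
      have h3 : (h : Vilenkin p) 1 = 0 := h.2 1 one_pos
      have h4 : (h' : Vilenkin p) 1 = 0 := h'.2 1 one_pos
      have h5 : ζ = ζ' := by simpa [frac, h3, h4] using h2
      subst h5
      rw [add_right_inj] at h1
      rw [Subtype.ext h1]
    · rintro ⟨y, hy⟩
      have hs : ∀ j, (A p).symm y j = y (j - 1) := fun j => rfl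
      -- A moves coordinate 1 to coordinate 0, so the digit ζ is read off from y at 0.
      refine ⟨⟨y 0, (A p).symm y - frac p (y 0), fun j hj => ?_⟩, Subtype.ext ?_⟩
      · rw [sub_apply, hs]
        rcases eq_or_ne j 1 with rfl | h1
        · simp [frac]
        · rw [hy (j - 1) (by lia)]
          simp [frac, Pi.single_eq_of_ne h1]
      · simp

theorem coe_fracProdEquiv (ζ : ZMod p) (h : H p) :
    (fracProdEquiv p (ζ, h) : Vilenkin p) = A p (frac p ζ + h) := rfl

theorem sum_tsum_A_add_frac [NeZero p] (g : Vilenkin p → ℝ) (x : Vilenkin p)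
    (hg : Summable fun h : H p => g (A p x + h)) :
    ∑ ζ : ZMod p, ∑' h : H p, g (A p (x + frac p ζ + h)) = ∑' h : H p, g (A p x + h) := by
  have h1 := (fracProdEquiv p).tsum_eq fun h : H p => g (A p x + h)
  have h2 := (fracProdEquiv p).summable_iff.2 hg
  refine Eq.trans ?_ (h2.tsum_prod.symm.trans h1)
  rw [tsum_fintype]
  refine Finset.sum_congr rfl fun ζ _ => tsum_congr fun h => ?_
  rw [Function.comp_apply, coe_fracProdEquiv, add_assoc, map_add]

variable [NeZero p]

theorem exists_compA_eq (f : L2 p) : ∃ g : L2 p, compA g = f := by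
  have hmap : (haar p).map (A p).symm =
      (addEquivAddHaarChar (A p).symm)⁻¹ • haar p := by
    conv_rhs => rw [← addEquivAddHaarChar_smul_map (haar p) (A p).symm]
    rw [smul_smul, inv_mul_cancel₀ (addEquivAddHaarChar_pos (A p).symm).ne', one_smul]
  have h1 : MemLp f 2 ((haar p).map (A p).symm) := by
    rw [hmap]
    exact (Lp.memLp f).smul_measure
      (c := ((addEquivAddHaarChar (A p).symm)⁻¹ : NNReal)) ENNReal.coe_ne_top
  have h2 : MemLp (fun x => f ((A p).symm x)) 2 (haar p) :=
    h1.comp_of_map (A p).symm.continuous.measurable.aemeasurable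
  refine ⟨h2.toLp, Lp.ext ?_⟩
  filter_upwards [coeFn_compA h2.toLp, quasiMeasurePreserving_A.ae h2.coeFn_toLp] with x hx hx'
  rw [hx, hx']
  simp

/-- Needed to regroup the periodization by cosets, since `tsum` takes the value 0 on families that
are not summable. -/
theorem ae_summable_norm_sq (f : L2 p) :
    ∀ᵐ x ∂haar p, Summable fun h : H p => ‖f (x + h)‖ ^ 2 := by
  filter_upwards [ae_summable_translates 0 (integrable_mul_conj f f)] with x hx
  refine Summable.congr (f := fun h : H p => ‖f (x + h) * conj (f (x + h))‖) hx fun h => ?_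
  rw [norm_mul, RCLike.norm_conj, sq]

variable {V : ℤ → Submodule ℂ (L2 p)} {φ : L2 p}

/-- With f = φ the bracket identity reads P = P², so P takes only the values 0 and 1. -/
theorem IsParsevalFMRA.periodization_eq (hV : IsParsevalFMRA V φ) :
    ∀ᵐ ω ∂haar p, periodization φ ω = (E φ).indicator (fun _ => (1 : ℝ)) ω := by
  filter_upwards [bracket_fourier_self (hV.isClosed 0) hV.parseval hV.scaling_mem] with ω hω
  rw [bracket_self, Complex.conj_ofReal, ← Complex.ofReal_mul, Complex.ofReal_inj] at hω
  change periodization φ ω = periodization φ ω * periodization φ ω at hω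
  by_cases h : periodization φ ω = 0
  · simp [E, h]
  · have : periodization φ ω = 1 := (mul_right_cancel₀ h (by rw [one_mul]; exact hω)).symm
    simp [E, this]

theorem IsParsevalFMRA.norm_lowPass_sq (hV : IsParsevalFMRA V φ) :
    ∀ᵐ ω ∂haar p, ‖lowPass φ ω‖ ^ 2 = ∑' h : H p, ‖fourier φ (A p (ω + h))‖ ^ 2 := by
  -- ψ is φ(A⁻¹ ·): it lies in V_{-1} ⊆ V_0, and [ψ̂, φ̂] is a constant multiple of m_φ.
  obtain ⟨ψ, hψ⟩ := exists_compA_eq φ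
  have hψV : ψ ∈ V 0 := by
    have h1 : ψ ∈ V (-1) := (hV.mem_iff (-1) ψ).2 (by rw [hψ]; exact hV.scaling_mem)
    exact hV.le_succ (-1) h1
  have hF := fourier_eq_fourier_compA ψ
  rw [hψ] at hF
  filter_upwards [bracket_fourier_self (hV.isClosed 0) hV.parseval hψV,
    bracket_congr_ae hF hF, bracket_congr_ae hF (ae_eq_refl (fourier φ))] with ω h1 h2 h3
  rw [h2, h3, bracket_const_mul_left, bracket_const_mul_left, bracket_const_mul_right,
    bracket_self, ← mul_assoc, Complex.mul_conj, Complex.mul_conj, map_mul,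
    Complex.ofReal_mul] at h1
  -- Both sides are quadratic in ψ̂, so each carries the same factor |c|², where c is `scaleA p`.
  have h4 := mul_left_cancel₀ (by simpa using scaleA_ne_zero) h1
  rw [Complex.ofReal_inj, Complex.normSq_eq_norm_sq] at h4
  exact h4.symm

end Vilenkin

theorem mainTheorem6 (p : ℕ) [NeZero p] (hp : 2 ≤ p)
    (V : ℤ → Submodule ℂ (Vilenkin.L2 p)) (φ : Vilenkin.L2 p)
    (hV : Vilenkin.IsParsevalFMRA V φ) :
    ∀ᵐ ω ∂(Vilenkin.haar p),
      ∑ ζ ∈ Finset.range p, ‖Vilenkin.lowPass φ (ω + Vilenkin.frac p (ζ : ZMod p))‖ ^ 2 =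
        (Vilenkin.E φ).indicator (fun _ => (1 : ℝ)) (Vilenkin.A p ω) := by
  -- The periodization is evaluated at Aω and the filter at the finitely many points ω + 0.ζ;
  -- dilation and translation pull null sets back to null sets.
  filter_upwards [Vilenkin.quasiMeasurePreserving_A.ae hV.periodization_eq,
    Vilenkin.quasiMeasurePreserving_A.ae (Vilenkin.ae_summable_norm_sq (Vilenkin.fourier φ)),
    ae_all_iff.2 fun ζ : ZMod p =>
      Vilenkin.ae_forall_translate hV.norm_lowPass_sq (Vilenkin.frac p ζ)] with ω h1 h2 h3
  rw [Vilenkin.sum_range_natCast_zmod fun ζ => ‖Vilenkin.lowPass φ (ω + Vilenkin.frac p ζ)‖ ^ 2,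
    ← h1]
  simp only [h3]
  exact Vilenkin.sum_tsum_A_add_frac (fun x => ‖Vilenkin.fourier φ x‖ ^ 2) ω h2
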